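/- **Theorem (Function value decrease in successful iterations).** *Function class.* Let $n\in\mathbb N$, $p\ge 3$, $L>0$. Let $f:\mathbb R^n\to\mathbb R$ be $p$ times continuously differentiable and bounded below, with $\|\nabla^p f(x)-\nabla^p f(y)\|\le (p-1)!\,L\,\|x-y\|$ for all $x,y$. Here $\|v\|$ is the Euclidean norm of a vector and $\|T\|=\max_{\|v_1\|=\dots=\|v_j\|=1}|T[v_1,\dots,v_j]|$ for a $j$th-order tensor. *Model.* Let $0<\epsilon<1$, $a\in[0,\tfrac12]$, $\delta=\epsilon^a$; let $p'=p+1$ if $p$ is odd and $p'=p+2$ if $p$ is even. Write $T_p(x,s)=f(x)+\sum_{j=1}^p\frac1{j!}\nabla^jf(x)[s]^j$ and let $\lambda_{\min}[\nabla^2 f(x)]$ be the smallest eigenvalue of the Hessian. The SoS Taylor model at $x$ with parameter $\sigma$ is $$m_c^{\sigma}(x,s)=T_p(x,s)+\frac{\mu(x)}2\|s\|^2+\frac{\sigma}{p'}\|s\|^{p'},$$ where $\mu(x)=0$ if $\lambda_{\min}[\nabla^2 f(x)]\ge\delta$, $\mu(x)=\delta$ if $0<\lambda_{\min}[\nabla^2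 f(x)]<\delta$, and $\mu(x)=\delta-\lambda_{\min}[\nabla^2 f(x)]$ if $\lambda_{\min}[\nabla^2 f(x)]\le 0$. A polynomial is SoS-convex if its Hessian equals $V(s)^TV(s)$ for some polynomial matrix $V(s)$. *Algorithm.* Fix $\sigma_{\min}>0$, $0<\eta<1$, $\gamma_1>1>\gamma_2>0$; put $x_0=0$, $\sigma^r_0=\sigma_{\min}$. For $k=0,1,2,\dots$: if $\|\nabla f(x_k)\|\le\epsilon$, terminate. Otherwise let $\bar\sigma_k$ be the least $\sigma$ such that $m_c^{\sigma}(x_k,\cdot)$ is SoS-convex, let $\sigma_k=\max\{\bar\sigma_k,\sigma^r_k\}$, let $s_k$ be the global minimizer of $m_c^{\sigma_k}(x_k,\cdot)$, and let $\rho_k=\frac{f(x_k)-f(x_k+s_k)}{f(x_k)-T_p(x_k,s_k)}$. If $\rho_k>\eta$, the iteration is *successful*: $x_{k+1}=x_k+s_k$ and $\sigma^r_{k+1}=\max\{\gamma_2\sigma_k,\sigma_{\min}\}$. Otherwise $x_{k+1}=x_k$ and $\sigma^r_{k+1}=\gamma_1\sigma_k$. Suppose that $\|\nabla^jf(x_k)\|\le\Lambda_j$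 for $j=1,\dots,p$ at every iterate $x_k$ at which the algorithm does not terminate. *Claim.* There are constants $\kappa_1,\kappa_2,\hat\kappa_3,\hat\kappa_4>0$, depending only on $n,p,L,\Lambda_1,\dots,\Lambda_p,\sigma_{\min},\eta,\gamma_1$ (in particular not on $k$, $\epsilon$ or $a$), such that in every successful iteration $k$, with $H_k=\nabla^2f(x_k)$: - Case 2 (locally nonconvex): if $\lambda_{\min}[H_k]<0$, then $f(x_k)-f(x_k+s_k)>\frac{\eta\hat\kappa_3^2}{2(\Lambda_2+1)}\,\epsilon^2$; and, if moreover the algorithm does not terminate at $x_{k+1}$, that is $\|\nabla f(x_{k+1})\|>\epsilon$: - Case 1 (locally strongly convex), $p$ odd: if $\lambda_{\min}[H_k]\ge\epsilon^a$, then $f(x_k)-f(x_k+s_k)>\kappa_1\eta\,\epsilon^{\frac{p+1+a(p-2)}{p}}$; - Case 1, $p$ even: if $\lambda_{\min}[H_k]\ge\epsilon^a$, then $f(x_k)-f(x_k+s_k)>\kappa_2\eta\,\epsilon^{\frac{p+2+\max\{1,a(p-1)\}}{p+1}}$; - Case 3 (locally nearly strongly convex): if $0\le\lambda_{\min}[H_k]\le\epsilon^a$,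 then $f(x_k)-f(x_k+s_k)>\frac{\eta\hat\kappa_4^2}{2}\,\epsilon^{2-a}$. -/

import Mathlib

noncomputable section

namespace ARpSoS

/-! ### SoS-convexity -/

/-- A polynomial matrix `H` is an SoS-matrix if `H = Vᵀ V` for some (rectangular) polynomial
matrix `V`. -/
def IsSOSMatrix {n : ℕ} (H : Matrix (Fin n) (Fin n) (MvPolynomial (Fin n) ℝ)) : Prop :=
  ∃ (m : ℕ) (V : Matrix (Fin m) (Fin n) (MvPolynomial (Fin n) ℝ)), H = V.transpose * V

/-- The Hessian of a polynomial, as a polynomial matrix. -/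
def polyHessian {n : ℕ} (q : MvPolynomial (Fin n) ℝ) :
    Matrix (Fin n) (Fin n) (MvPolynomial (Fin n) ℝ) :=
  Matrix.of fun i j => MvPolynomial.pderiv i (MvPolynomial.pderiv j q)

/-- A function on `ℝⁿ` is SoS-convex if it is given by a polynomial whose Hessian is an
SoS-matrix. (The polynomial is unique, since `ℝ` is infinite.) -/
def IsSOSConvex {n : ℕ} (g : EuclideanSpace ℝ (Fin n) → ℝ) : Prop :=
  ∃ q : MvPolynomial (Fin n) ℝ,
    (∀ s : EuclideanSpace ℝ (Fin n), MvPolynomial.eval (fun i => s i) q = g s) ∧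
      IsSOSMatrix (polyHessian q)

/-! ### The function class -/

/-- `f` is `p` times continuously differentiable, bounded below, and its `p`th derivative is
globally Lipschitz with constant `(p-1)! L`. The norm of a derivative tensor is
`max {|T[v₁, …, v_j]| : ‖v₁‖ = … = ‖v_j‖ = 1}`, i.e. Mathlib's operator norm. -/
structure IsCp1 {n : ℕ} (p : ℕ) (L : ℝ) (f : EuclideanSpace ℝ (Fin n) → ℝ) : Prop where
  contDiff : ContDiff ℝ p f
  bddBelow : BddBelow (Set.range f)
  lipschitz : ∀ x y, ‖iteratedFDeriv ℝ p f x - iteratedFDeriv ℝ p f y‖ ≤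
    ((p - 1).factorial : ℝ) * L * ‖x - y‖

/-! ### The SoS Taylor model -/

/-- The `p`th order Taylor model `T_p(x, s)` of `f`. -/
def taylorModel {n : ℕ} (f : EuclideanSpace ℝ (Fin n) → ℝ) (p : ℕ)
    (x s : EuclideanSpace ℝ (Fin n)) : ℝ :=
  f x + ∑ j ∈ Finset.Icc 1 p, (1 / (j.factorial : ℝ)) * iteratedFDeriv ℝ j f x (fun _ => s)

/-- The power `p'` of the regularization term. -/
def regOrder (p : ℕ) : ℕ := if Odd p then p + 1 else p + 2

/-- The Hessian matrix of `f` at `x`. -/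
def hessian {n : ℕ} (f : EuclideanSpace ℝ (Fin n) → ℝ) (x : EuclideanSpace ℝ (Fin n)) :
    Matrix (Fin n) (Fin n) ℝ :=
  Matrix.of fun i j =>
    iteratedFDeriv ℝ 2 f x ![EuclideanSpace.single i 1, EuclideanSpace.single j 1]

/-- The smallest eigenvalue of the Hessian of `f` at `x`. -/
def lamMin {n : ℕ} (f : EuclideanSpace ℝ (Fin n) → ℝ) (x : EuclideanSpace ℝ (Fin n)) : ℝ :=
  sInf (spectrum ℝ (hessian f x))

/-- The coefficient of `‖s‖² / 2` by which the model perturbs the Taylor model, as a function of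
the smallest eigenvalue `l` of the Hessian: none in the locally strongly convex case (`δ ≤ l`),
`δ` in the locally nearly strongly convex case (`0 < l < δ`), and `-l + δ` in the locally
nonconvex case (`l ≤ 0`). -/
def perturbation (δ l : ℝ) : ℝ := if δ ≤ l then 0 else if 0 < l then δ else -l + δ

/-- The `p`th order SoS Taylor model `m_c(x, s)` with regularization parameter `σ`. -/
def sosModel {n : ℕ} (f : EuclideanSpace ℝ (Fin n) → ℝ) (p : ℕ) (δ σ : ℝ)
    (x s : EuclideanSpace ℝ (Fin n)) : ℝ :=
  taylorModel f p x s + perturbation δ (lamMin f x) / 2 * ‖s‖ ^ 2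
    + σ / (regOrder p : ℝ) * ‖s‖ ^ regOrder p

/-! ### The algorithm -/

/-- Iteration `k` is performed: the termination test `‖∇f(x_j)‖ ≤ ε` has failed at
`x_0, …, x_k`. -/
def Performed {n : ℕ} (f : EuclideanSpace ℝ (Fin n) → ℝ) (ε : ℝ)
    (x : ℕ → EuclideanSpace ℝ (Fin n)) (k : ℕ) : Prop :=
  ∀ j ≤ k, ε < ‖gradient f (x j)‖

/-- The ratio test `ρ > η` for the trial step `s` from `x`. -/
def Successful {n : ℕ} (f : EuclideanSpace ℝ (Fin n) → ℝ) (p : ℕ) (η : ℝ)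
    (x s : EuclideanSpace ℝ (Fin n)) : Prop :=
  η < (f x - f (x + s)) / (f x - taylorModel f p x s)

/-- The sequences `x` (iterates), `s` (steps), `σr` (adaptive regularization parameters), `σbar`
(least parameters making the model SoS-convex) and `σ` (regularization parameters used) are
produced by the adaptive `p`th order regularization method with SoS Taylor models. Nothing is
required of them after termination. -/
structure IsRun {n : ℕ} (f : EuclideanSpace ℝ (Fin n) → ℝ) (p : ℕ) (ε δ σmin η γ₁ γ₂ : ℝ)
    (x s : ℕ → EuclideanSpace ℝ (Fin n)) (σr σbar σ : ℕ → ℝ) : Prop where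
  x_zero : x 0 = 0
  σr_zero : σr 0 = σmin
  sos_program : ∀ k, Performed f ε x k →
    IsLeast {t : ℝ | IsSOSConvex (sosModel f p δ t (x k))} (σbar k)
  σ_eq : ∀ k, Performed f ε x k → σ k = max (σbar k) (σr k)
  step : ∀ k, Performed f ε x k → IsMinOn (sosModel f p δ (σ k) (x k)) Set.univ (s k)
  success : ∀ k, Performed f ε x k → Successful f p η (x k) (s k) →
    x (k + 1) = x k + s k ∧ σr (k + 1) = max (γ₂ * σ k) σmin
  failure : ∀ k, Performed f ε x k → ¬ Successful f p η (x k) (s k) →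
    x (k + 1) = x k ∧ σr (k + 1) = γ₁ * σ k

end ARpSoS

end

/-! A successful iteration decreases `f` by more than `η D`, where `D = f(x) - T_p(x,s)` is the
predicted decrease, so everything reduces to lower bounds on `D`. Write `t = ‖s‖`, `δ = ε ^ a`, `μ`
for the perturbation, `p'` for the order of the regularization and `M = (p-1)! L`.

Since `s` globally minimizes the model, three bounds hold. Comparison with the value at `0` gives `D
≥ μ t²/2 + σ t^p'/p'`. Comparison with a step of length proportional to `ε` along the negative
gradient gives `D ≥ c ε²`, which is Case 2 (`cauchy_decrease`, `decrease_of_cauchy`). Convexity of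
the model along the ray through `s`, together with the Hessian bound `∇²f + μ I ⪰ δ I` at the
origin, gives `D ≥ (δ/8) min(t, δ/(32K))²` (`convex_decrease`).

For Cases 1 and 3, stationarity of `s` and Taylor's theorem give `ε < ‖∇f(x+s)‖ ≤ M t^p + μ t + σ
t^(p'-1)`, so one of the three terms is at least `ε/3`. Each alternative bounds `t` from below and
pairs with one of the bounds on `D`: the Taylor term with convexity (`decrease_of_le_taylor`), the
perturbation with `μ t²/2` (`decrease_of_le_perturbation`), the regularization with `σ t^p'/p'`
(`decrease_of_le_reg`). The last needs an upper bound `σ ≤ S ε^(-w)`, proved by induction along the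
run (`IsRun.sigma_bounds`) from two sources.

First, after an unsuccessful iteration the Taylor error `M t^(p+1)` is comparable to `σ t^p'`. For
odd `p` this bounds `σ`. For even `p` it bounds `σ t`, and `t` is at least a multiple of `ε`
(`le_of_not_successful`).

Second, the least SoS-convexifying parameter is at most `δ (K/δ)^(p'-2)` (`isSOSConvex_sosModel`).
The quadratic part of the model supplies `δ I`, the regularization supplies `σ ‖X‖^(p'-2) I`, and
their sum absorbs the Hessians of all Taylor terms of order at least 3. This rests on a
sum-of-squares form of Young's inequality, monomial by monomial, at a free scale `τ`
(`isDominated_monomial`); the scale used is `τ = δ/K`. -/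

noncomputable section

namespace ARpSoS

/-! ### Taylor expansion of maps between normed spaces -/

section Taylor

variable {E G : Type} [NormedAddCommGroup E] [NormedSpace ℝ E]
  [NormedAddCommGroup G] [NormedSpace ℝ G]

/-- The Taylor polynomial of degree `m` of `F` at `x`, evaluated at the displacement `s`. -/
def taylorPoly (F : E → G) (m : ℕ) (x s : E) : G :=
  ∑ j ∈ Finset.range (m + 1), (1 / (j.factorial : ℝ)) • iteratedFDeriv ℝ j F x (fun _ => s)

/-- The second derivative is fixed by the linear isometry that flips its two arguments, and linear
maps commute with iterated differentiation. -/
theorem iteratedFDeriv_fderiv_fderiv_symm {F : E → G} {m : ℕ} (hF : ContDiff ℝ (m + 2 : ℕ) F)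
    (x : E) (u : Fin m → E) (v w : E) :
    iteratedFDeriv ℝ m (fderiv ℝ (fderiv ℝ F)) x u v w =
      iteratedFDeriv ℝ m (fderiv ℝ (fderiv ℝ F)) x u w v := by
  set g := fderiv ℝ (fderiv ℝ F) with hg
  have hsymm : (ContinuousLinearMap.flipₗᵢ ℝ E E G) ∘ g = g := by
    funext y
    ext a b
    have h : IsSymmSndFDerivAt ℝ F y := (hF.contDiffAt).isSymmSndFDerivAt (by simp)
    simpa [hg] using h b a
  have h := ContinuousLinearEquiv.iteratedFDeriv_comp_left (𝕜 := ℝ) (E := E)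
    (F := E →L[ℝ] E →L[ℝ] G) (G := E →L[ℝ] E →L[ℝ] G) (f := g) (x := x) (i := m)
    (ContinuousLinearMap.flipₗᵢ ℝ E E G).toContinuousLinearEquiv
  change iteratedFDeriv ℝ m ((ContinuousLinearMap.flipₗᵢ ℝ E E G) ∘ g) x = _ at h
  rw [hsymm] at h
  conv_lhs => rw [h]
  rfl

/-- Full permutation symmetry is not needed: when all other arguments equal `s`, induction moves `v`
to the second-to-last slot, and one swap of the last two finishes. The codomain is quantified inside
because the induction passes to `fderiv ℝ F`. -/
theorem iteratedFDeriv_update_const {m : ℕ} : ∀ {G : Type} [NormedAddCommGroup G]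
    [NormedSpace ℝ G] {F : E → G}, ContDiff ℝ (m + 1 : ℕ) F → ∀ (x s v : E) (i : Fin (m + 1)),
    iteratedFDeriv ℝ (m + 1) F x (Function.update (fun _ => s) i v) =
      iteratedFDeriv ℝ m (fderiv ℝ F) x (fun _ => s) v := by
  induction m with
  | zero =>
    intro G _ _ F hF x s v i
    have hi : i = 0 := Fin.eq_zero i
    subst hi
    simp
  | succ m ih =>
    intro G _ _ F hF x s v i
    rw [iteratedFDeriv_succ_apply_right]
    refine Fin.lastCases ?_ (fun i => ?_) i
    · rw [Fin.init_update_last, Function.update_self]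
      rfl
    · have hd : ContDiff ℝ (m + 1 : ℕ) (fderiv ℝ F) := hF.fderiv_right (by norm_cast)
      have h1 : Fin.init (Function.update (fun _ : Fin (m + 2) => s) i.castSucc v) =
          Function.update (fun _ : Fin (m + 1) => s) i v := by
        rw [Fin.init_update_castSucc]
        rfl
      rw [h1, Function.update_of_ne (Fin.castSucc_lt_last i).ne', ih hd,
        iteratedFDeriv_succ_apply_right (m := fun _ => s),
        iteratedFDeriv_fderiv_fderiv_symm hF]
      rfl

/-- Differentiating the diagonal term of order `j + 1` yields `j + 1` equal summands by symmetry,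
and `(j + 1) / (j + 1)! = 1 / j!`. This makes Taylor's theorem an induction on the order. -/
theorem hasFDerivAt_taylorPoly {F : E → G} {m : ℕ} (hF : ContDiff ℝ (m + 1 : ℕ) F) (x s : E) :
    HasFDerivAt (taylorPoly F (m + 1) x) (taylorPoly (fderiv ℝ F) m x s) s := by
  have hterm : ∀ j ∈ Finset.range (m + 1),
      HasFDerivAt (fun y => (1 / ((j + 1).factorial : ℝ)) •
        iteratedFDeriv ℝ (j + 1) F x (fun _ => y))
        ((1 / (j.factorial : ℝ)) • iteratedFDeriv ℝ j (fderiv ℝ F) x (fun _ => s)) s := by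
    intro j hj
    have hFj : ContDiff ℝ (j + 1 : ℕ) F :=
      hF.of_le (by exact_mod_cast Nat.succ_le_succ (Finset.mem_range_succ_iff.1 hj))
    have h := (HasFDerivAt.multilinear_comp (iteratedFDeriv ℝ (j + 1) F x)
      (g := fun _ y => y) (g' := fun _ => ContinuousLinearMap.id ℝ E)
      (fun _ => hasFDerivAt_id s)).const_smul (1 / ((j + 1).factorial : ℝ))
    convert! h using 1
    ext v
    have : ∀ i : Fin (j + 1), ((iteratedFDeriv ℝ (j + 1) F x).toContinuousLinearMap
        (fun _ => s) i ∘L ContinuousLinearMap.id ℝ E) v =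
        iteratedFDeriv ℝ j (fderiv ℝ F) x (fun _ => s) v := fun i =>
      iteratedFDeriv_update_const hFj x s v i
    simp only [FunLike.coe_smul, Pi.smul_apply, FunLike.coe_sum, Finset.sum_apply, this,
      Finset.sum_const, Finset.card_univ, Fintype.card_fin]
    rw [← Nat.cast_smul_eq_nsmul ℝ, smul_smul]
    congr 1
    rw [Nat.factorial_succ]
    push_cast
    field_simp
  have hsum := HasFDerivAt.fun_sum hterm
  have h0 : HasFDerivAt (fun y : E => (1 / ((0 : ℕ).factorial : ℝ)) •
      iteratedFDeriv ℝ 0 F x (fun _ => y)) (0 : E →L[ℝ] G) s := by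
    simpa using hasFDerivAt_const (F x) s
  have h := hsum.add h0
  rw [add_zero] at h
  refine h.congr_of_eventuallyEq (Filter.Eventually.of_forall fun y => ?_)
  simp only [taylorPoly, Pi.add_apply]
  rw [Finset.sum_range_succ' _ (m + 1)]

theorem taylorPoly_zero_right {F : E → G} (m : ℕ) (x : E) : taylorPoly F m x 0 = F x := by
  rw [taylorPoly, Finset.sum_range_succ']
  simp only [Nat.factorial_zero, Nat.cast_one, div_one, one_smul, iteratedFDeriv_zero_apply]
  rw [Finset.sum_eq_zero, zero_add]
  intro j _
  rw [(iteratedFDeriv ℝ (j + 1) F x).map_coord_zero 0 rfl, smul_zero]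

/-- If the derivative of `g` is bounded by `M ‖s‖ ^ m`, then `g` is bounded by
`M ‖s‖ ^ (m + 1)`. -/
theorem norm_sub_le_of_hasFDerivAt_pow {g : E → G} {g' : E → E →L[ℝ] G} {M : ℝ} {m : ℕ}
    (hM : 0 ≤ M) (hg : ∀ s, HasFDerivAt g (g' s) s) (hg' : ∀ s, ‖g' s‖ ≤ M * ‖s‖ ^ m) (s : E) :
    ‖g s - g 0‖ ≤ M * ‖s‖ ^ (m + 1) := by
  -- The mean value inequality on the ball of radius `‖s‖` suffices; the factor `1 / (m + 1)` from
  -- integration is given up.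
  have h := (convex_closedBall (0 : E) ‖s‖).norm_image_sub_le_of_norm_hasFDerivWithin_le
    (f := g) (f' := g') (C := M * ‖s‖ ^ m) (fun y _ => (hg y).hasFDerivWithinAt)
    (fun y hy => (hg' y).trans ?_) (x := 0) (y := s) (by simp) (by simp)
  · simpa [pow_succ, mul_assoc] using h
  · have : ‖y‖ ≤ ‖s‖ := by simpa using hy
    gcongr

theorem norm_iteratedFDeriv_fderiv_sub (F : E → G) (m : ℕ) (x y : E) :
    ‖iteratedFDeriv ℝ m (fderiv ℝ F) x - iteratedFDeriv ℝ m (fderiv ℝ F) y‖ =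
      ‖iteratedFDeriv ℝ (m + 1) F x - iteratedFDeriv ℝ (m + 1) F y‖ := by
  rw [iteratedFDeriv_succ_eq_comp_right, iteratedFDeriv_succ_eq_comp_right]
  simp only [Function.comp_apply]
  exact (((continuousMultilinearCurryRightEquiv' ℝ m E G).symm.map_sub _ _).symm ▸
    (LinearIsometryEquiv.norm_map _ _).symm)

/-- Taylor's theorem: if the `m`th derivative of `F` is `M`-Lipschitz, then the error of the
`m`th order Taylor polynomial is at most `M ‖s‖ ^ (m + 1)`. -/
theorem norm_sub_taylorPoly_le {M : ℝ} (hM : 0 ≤ M) {m : ℕ} : ∀ {G : Type}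
    [NormedAddCommGroup G] [NormedSpace ℝ G] {F : E → G}, ContDiff ℝ m F →
    (∀ x y, ‖iteratedFDeriv ℝ m F x - iteratedFDeriv ℝ m F y‖ ≤ M * ‖x - y‖) →
    ∀ x s : E, ‖F (x + s) - taylorPoly F m x s‖ ≤ M * ‖s‖ ^ (m + 1) := by
  induction m with
  | zero =>
    intro G _ _ F hF hL x s
    have h := hL (x + s) x
    rw [iteratedFDeriv_zero_eq_comp] at h
    simp only [Function.comp_apply, ← map_sub, LinearIsometryEquiv.norm_map] at h
    simpa [taylorPoly] using h
  | succ m ih =>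
    intro G _ _ F hF hL x s
    have hd : ContDiff ℝ m (fderiv ℝ F) := hF.fderiv_right (by norm_cast)
    have hdiff : Differentiable ℝ F := hF.differentiable (by simp)
    have hg : ∀ s, HasFDerivAt (fun s => F (x + s) - taylorPoly F (m + 1) x s)
        (fderiv ℝ F (x + s) - taylorPoly (fderiv ℝ F) m x s) s := fun s =>
      ((hasFDerivAt_comp_add_left x).2 (hdiff (x + s)).hasFDerivAt).sub (hasFDerivAt_taylorPoly hF x s)
    have h := norm_sub_le_of_hasFDerivAt_pow (m := m + 1) hM hg
      (ih hd (fun x y => (norm_iteratedFDeriv_fderiv_sub F m x y).trans_le (hL x y)) x) s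
    simpa [taylorPoly_zero_right] using h

end Taylor

end ARpSoS

end

noncomputable section

namespace ARpSoS

open MvPolynomial

/-! ### Sums of squares of polynomials -/

section SumSq

variable {n : ℕ}

theorem isSumSq_C {c : ℝ} (hc : 0 ≤ c) : IsSumSq (C c : MvPolynomial (Fin n) ℝ) := by
  rw [← Real.mul_self_sqrt hc, C_mul]
  exact IsSumSq.mul_self _

theorem isSumSq_pow {R : Type*} [CommRing R] {a : R} (ha : IsSumSq a) (k : ℕ) :
    IsSumSq (a ^ k) := by
  induction k with
  | zero => simp
  | succ k ih => rw [pow_succ]; exact ih.mul ha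

/-- `1 + a ^ h - a ^ b` is a sum of squares if `a` is one and `b ≤ h`. -/
theorem isSumSq_one_add_pow_sub_pow {R : Type*} [CommRing R] {a : R} (ha : IsSumSq a) {b h : ℕ}
    (hb : b ≤ h) : IsSumSq (1 + a ^ h - a ^ b) := by
  obtain ⟨c, rfl⟩ := Nat.exists_eq_add_of_le hb
  have hgeom : ∀ k : ℕ, IsSumSq (∑ i ∈ Finset.range k, a ^ i) := fun k =>
    IsSumSq.sum fun i _ => isSumSq_pow ha i
  -- Both `1 - a ^ b` and `1 - a ^ c` contain the factor `1 - a`, so their product is a square times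
  -- two geometric sums.
  have key : 1 + a ^ (b + c) - a ^ b = a ^ c + (1 - a) * (1 - a) *
      ((∑ i ∈ Finset.range b, a ^ i) * ∑ i ∈ Finset.range c, a ^ i) := by
    have hb := mul_neg_geom_sum a b
    have hc := mul_neg_geom_sum a c
    calc 1 + a ^ (b + c) - a ^ b = a ^ c + (1 - a ^ b) * (1 - a ^ c) := by ring
      _ = _ := by rw [← hb, ← hc]; ring
  rw [key]
  exact (isSumSq_pow ha c).add ((IsSumSq.mul_self _).mul ((hgeom b).mul (hgeom c)))

/-- The polynomial `X₁² + ⋯ + Xₙ²`. -/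
def normSqPoly (n : ℕ) : MvPolynomial (Fin n) ℝ := ∑ i, X i ^ 2

theorem isSumSq_normSqPoly : IsSumSq (normSqPoly n) := IsSumSq.sum_sq _ _

theorem eval_normSqPoly (s : EuclideanSpace ℝ (Fin n)) :
    eval (fun i => s i) (normSqPoly n) = ‖s‖ ^ 2 := by
  simp [normSqPoly, EuclideanSpace.norm_sq_eq]

/-- The property is multiplicative, by `P Q - p q = (P - p) Q + p (Q - q)`. It therefore reduces to
a single variable, where the difference is the sum of the other squares. -/
theorem isSumSq_normSqPoly_pow_sub_monomial (β : Fin n →₀ ℕ) :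
    IsSumSq (normSqPoly n ^ β.degree - (monomial β (1 : ℝ)) ^ 2) := by
  have hadd : ∀ β γ : Fin n →₀ ℕ,
      IsSumSq (normSqPoly n ^ β.degree - (monomial β (1 : ℝ)) ^ 2) →
      IsSumSq (normSqPoly n ^ γ.degree - (monomial γ (1 : ℝ)) ^ 2) →
      IsSumSq (normSqPoly n ^ (β + γ).degree - (monomial (β + γ) (1 : ℝ)) ^ 2) := by
    intro β γ hβ hγ
    have hm : monomial (β + γ) (1 : ℝ) = monomial β 1 * monomial γ 1 := by
      rw [monomial_mul, one_mul]
    have key : normSqPoly n ^ (β + γ).degree - (monomial (β + γ) (1 : ℝ)) ^ 2 =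
        (normSqPoly n ^ β.degree - (monomial β (1 : ℝ)) ^ 2) * normSqPoly n ^ γ.degree +
        (monomial β (1 : ℝ) * monomial β 1) *
          (normSqPoly n ^ γ.degree - (monomial γ (1 : ℝ)) ^ 2) := by
      rw [hm, map_add, pow_add]
      ring
    rw [key]
    exact (hβ.mul (isSumSq_pow isSumSq_normSqPoly _)).add ((IsSumSq.mul_self _).mul hγ)
  induction β using Finsupp.induction_linear with
  | zero => simp
  | add β γ hβ hγ => exact hadd β γ hβ hγ
  | single i k =>
    induction k with
    | zero => simp
    | succ k ih =>
      rw [Finsupp.single_add]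
      refine hadd _ _ ih ?_
      have : normSqPoly n ^ (Finsupp.single i 1).degree -
          (monomial (Finsupp.single i 1) (1 : ℝ)) ^ 2 = ∑ j ∈ Finset.univ.erase i, X j ^ 2 := by
        rw [Finsupp.degree_single, pow_one, normSqPoly,
          ← Finset.add_sum_erase _ _ (Finset.mem_univ i)]
        simp [X]
      rw [this]
      exact IsSumSq.sum_sq _ _

/-- A scaled monomial of degree at most `h` has its square dominated by `1 + (θ² ‖X‖²) ^ h`. -/
theorem isSumSq_one_add_sub_monomial (β : Fin n →₀ ℕ) {h : ℕ} (hβ : β.degree ≤ h) (θ : ℝ) :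
    IsSumSq (1 + (C (θ ^ 2) * normSqPoly n) ^ h - (monomial β (θ ^ β.degree)) ^ 2) := by
  have hm : monomial β (θ ^ β.degree) = C (θ ^ β.degree) * monomial β (1 : ℝ) := by
    rw [C_mul_monomial, mul_one]
  have key : 1 + (C (θ ^ 2) * normSqPoly n) ^ h - (monomial β (θ ^ β.degree)) ^ 2 =
      (1 + (C (θ ^ 2) * normSqPoly n) ^ h - (C (θ ^ 2) * normSqPoly n) ^ β.degree) +
      C (θ ^ β.degree) * C (θ ^ β.degree) *
        (normSqPoly n ^ β.degree - (monomial β (1 : ℝ)) ^ 2) := by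
    rw [hm, mul_pow (C (θ ^ 2)) _ β.degree, C_pow, C_pow]
    ring
  rw [key]
  refine (isSumSq_one_add_pow_sub_pow ?_ hβ).add
    ((IsSumSq.mul_self _).mul (isSumSq_normSqPoly_pow_sub_monomial β))
  exact (isSumSq_C (sq_nonneg θ)).mul isSumSq_normSqPoly

end SumSq

/-! ### SoS-matrices -/

section SOSMatrix

variable {n : ℕ} {H H₁ H₂ : Matrix (Fin n) (Fin n) (MvPolynomial (Fin n) ℝ)}

theorem IsSOSMatrix.of_fintype {ι : Type*} [Fintype ι]
    (V : Matrix ι (Fin n) (MvPolynomial (Fin n) ℝ)) : IsSOSMatrix (V.transpose * V) := by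
  classical
  let e := Fintype.equivFin ι
  refine ⟨Fintype.card ι, V.submatrix e.symm id, ?_⟩
  rw [Matrix.transpose_submatrix, Matrix.submatrix_mul_equiv, Matrix.submatrix_id_id]

theorem IsSOSMatrix.zero : IsSOSMatrix (0 : Matrix (Fin n) (Fin n) (MvPolynomial (Fin n) ℝ)) :=
  ⟨0, 0, by simp⟩

theorem IsSOSMatrix.add (h₁ : IsSOSMatrix H₁) (h₂ : IsSOSMatrix H₂) : IsSOSMatrix (H₁ + H₂) := by
  obtain ⟨m₁, V₁, rfl⟩ := h₁
  obtain ⟨m₂, V₂, rfl⟩ := h₂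
  rw [← Matrix.fromCols_mul_fromRows, ← Matrix.transpose_fromRows]
  exact IsSOSMatrix.of_fintype _

theorem IsSOSMatrix.sum {ι : Type*} {s : Finset ι}
    {F : ι → Matrix (Fin n) (Fin n) (MvPolynomial (Fin n) ℝ)} (h : ∀ i ∈ s, IsSOSMatrix (F i)) :
    IsSOSMatrix (∑ i ∈ s, F i) := by
  classical
  induction s using Finset.induction_on with
  | empty => simpa using IsSOSMatrix.zero
  | insert a s ha ih =>
    rw [Finset.sum_insert ha]
    exact (h a (Finset.mem_insert_self _ _)).add
      (ih fun i hi => h i (Finset.mem_insert_of_mem hi))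

theorem IsSOSMatrix.smul (h : IsSOSMatrix H) {a : MvPolynomial (Fin n) ℝ} (ha : IsSumSq a) :
    IsSOSMatrix (a • H) := by
  induction ha with
  | zero => simpa using IsSOSMatrix.zero
  | sq_add b _ ih =>
    rw [add_smul]
    refine IsSOSMatrix.add ?_ ih
    obtain ⟨m, V, rfl⟩ := h
    refine ⟨m, b • V, ?_⟩
    rw [Matrix.transpose_smul, Matrix.smul_mul, Matrix.mul_smul, smul_smul]

theorem isSOSMatrix_vecMulVec (v : Fin n → MvPolynomial (Fin n) ℝ) :
    IsSOSMatrix (Matrix.vecMulVec v v) := by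
  refine ⟨1, Matrix.of fun _ => v, ?_⟩
  ext i j : 1
  simp [Matrix.mul_apply, Matrix.vecMulVec_apply]

theorem isSOSMatrix_single {a : MvPolynomial (Fin n) ℝ} (ha : IsSumSq a) (i : Fin n) :
    IsSOSMatrix (Matrix.single i i a) := by
  have h := (isSOSMatrix_vecMulVec (Pi.single i (1 : MvPolynomial (Fin n) ℝ))).smul ha
  rwa [← Matrix.single_eq_single_vecMulVec_single, Matrix.smul_single, smul_eq_mul,
    mul_one] at h

theorem isSOSMatrix_smul_one {a : MvPolynomial (Fin n) ℝ} (ha : IsSumSq a) :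
    IsSOSMatrix (a • (1 : Matrix (Fin n) (Fin n) (MvPolynomial (Fin n) ℝ))) := by
  refine IsSOSMatrix.smul ⟨n, 1, by simp⟩ ha

theorem isSOSMatrix_smul_one_sub_single {a : MvPolynomial (Fin n) ℝ} (ha : IsSumSq a) (i : Fin n) :
    IsSOSMatrix (a • (1 : Matrix (Fin n) (Fin n) (MvPolynomial (Fin n) ℝ)) -
      Matrix.single i i a) := by
  have : a • (1 : Matrix (Fin n) (Fin n) (MvPolynomial (Fin n) ℝ)) - Matrix.single i i a =
      ∑ j ∈ Finset.univ.erase i, Matrix.single j j a := by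
    rw [sub_eq_iff_eq_add', Finset.add_sum_erase _ (fun j => Matrix.single j j a)
      (Finset.mem_univ i), Matrix.sum_single_eq_diagonal, Matrix.smul_one_eq_diagonal]
  rw [this]
  exact IsSOSMatrix.sum fun j _ => isSOSMatrix_single ha j

theorem isSOSMatrix_map_C {A : Matrix (Fin n) (Fin n) ℝ} (hA : A.PosSemidef) :
    IsSOSMatrix (A.map (C : ℝ →+* MvPolynomial (Fin n) ℝ)) := by
  obtain ⟨m, v, rfl⟩ := Matrix.posSemidef_iff_eq_sum_vecMulVec.1 hA
  refine ⟨m, Matrix.of fun k i => C (v k i), ?_⟩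
  ext i j : 1
  simp [Matrix.mul_apply, Matrix.sum_apply, Matrix.vecMulVec_apply]

end SOSMatrix

end ARpSoS

end

noncomputable section

namespace ARpSoS

open MvPolynomial

/-! ### Domination of polynomial matrices by `K τ (1 + (‖X‖ / τ) ^ (2 h))` -/

section Dominated

variable {n h : ℕ} {K K₁ K₂ : ℝ} {M M₁ M₂ : Matrix (Fin n) (Fin n) (MvPolynomial (Fin n) ℝ)}

/-- The polynomial `1 + (θ ‖X‖) ^ (2 h)`. -/
def barrier (n h : ℕ) (θ : ℝ) : MvPolynomial (Fin n) ℝ := 1 + (C (θ ^ 2) * normSqPoly n) ^ h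

theorem isSumSq_barrier (θ : ℝ) : IsSumSq (barrier n h θ) :=
  IsSumSq.one.add (isSumSq_pow ((isSumSq_C (sq_nonneg θ)).mul isSumSq_normSqPoly) h)

/-- `M + K τ (1 + (‖X‖ / τ) ^ (2 h))` is an SoS-matrix for all `0 < τ ≤ 1`. -/
def IsDominated (h : ℕ) (K : ℝ) (M : Matrix (Fin n) (Fin n) (MvPolynomial (Fin n) ℝ)) : Prop :=
  ∀ τ : ℝ, 0 < τ → τ ≤ 1 →
    IsSOSMatrix ((C (K * τ) * barrier n h τ⁻¹) •
      (1 : Matrix (Fin n) (Fin n) (MvPolynomial (Fin n) ℝ)) + M)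

theorem IsDominated.add (h₁ : IsDominated h K₁ M₁) (h₂ : IsDominated h K₂ M₂) :
    IsDominated h (K₁ + K₂) (M₁ + M₂) := by
  intro τ hτ hτ1
  convert! (h₁ τ hτ hτ1).add (h₂ τ hτ hτ1) using 1
  rw [add_mul, C_add, add_mul, add_smul]
  abel

theorem isDominated_zero (hK : 0 ≤ K) :
    IsDominated h K (0 : Matrix (Fin n) (Fin n) (MvPolynomial (Fin n) ℝ)) := by
  intro τ hτ _
  rw [add_zero]
  exact isSOSMatrix_smul_one ((isSumSq_C (by positivity)).mul (isSumSq_barrier _))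

theorem IsDominated.mono (h₁ : IsDominated h K₁ M) (hK : K₁ ≤ K₂) : IsDominated h K₂ M := by
  simpa using h₁.add (isDominated_zero (n := n) (h := h) (sub_nonneg.2 hK))

theorem IsDominated.sum {ι : Type*} {s : Finset ι} {K : ι → ℝ}
    {F : ι → Matrix (Fin n) (Fin n) (MvPolynomial (Fin n) ℝ)}
    (hF : ∀ i ∈ s, IsDominated h (K i) (F i)) : IsDominated h (∑ i ∈ s, K i) (∑ i ∈ s, F i) := by
  classical
  induction s using Finset.induction_on with
  | empty => simpa using isDominated_zero le_rfl
  | insert a s ha ih =>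
    rw [Finset.sum_insert ha, Finset.sum_insert ha]
    exact (hF a (Finset.mem_insert_self _ _)).add
      (ih fun i hi => hF i (Finset.mem_insert_of_mem hi))

theorem exists_add_of_le_degree {σ : Type*} (α : σ →₀ ℕ) {k : ℕ} (hk : k ≤ α.degree) :
    ∃ β γ : σ →₀ ℕ, α = β + γ ∧ β.degree = k := by
  classical
  induction k with
  | zero => exact ⟨0, α, by simp, by simp⟩
  | succ k ih =>
    obtain ⟨β, γ, rfl, hβ⟩ := ih (Nat.le_of_succ_le hk)
    have hγ : γ ≠ 0 := by
      rintro rfl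
      simp at hk
      omega
    obtain ⟨i, hi⟩ := Finsupp.ne_iff.1 hγ
    have hle : Finsupp.single i 1 ≤ γ := by
      rw [Finsupp.single_le_iff]
      exact Nat.one_le_iff_ne_zero.2 hi
    refine ⟨β + Finsupp.single i 1, γ - Finsupp.single i 1, ?_, by simp [hβ]⟩
    rw [add_assoc, add_tsub_cancel_of_le hle]

/-- Young's inequality at scale `τ`: split the monomial into two factors of degree at most `h`,
rescale each by `τ`, and complete the square. Positive degree is essential, since the rescaling
factor `τ ^ α.degree` must be at most `τ`. -/
theorem isDominated_monomial {α : Fin n →₀ ℕ} (hα : 1 ≤ α.degree) (hαh : α.degree + 1 ≤ 2 * h + 1)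
    (i j : Fin n) (c : ℝ) :
    IsDominated h (2 * |c|)
      (Matrix.single i j (monomial α c) + Matrix.single j i (monomial α c)) := by
  intro τ hτ hτ1
  obtain ⟨β, γ, rfl, hβ⟩ := exists_add_of_le_degree α (Nat.div_le_self α.degree 2)
  rw [map_add] at hα hαh hβ
  have hβh : β.degree ≤ h := by omega
  have hγh : γ.degree ≤ h := by omega
  set b := β.degree
  set g := γ.degree
  set P := monomial β (τ⁻¹ ^ b) with hP
  set Q := monomial γ (τ⁻¹ ^ g) with hQ
  -- With `P` and `Q` the rescaled factors and `e` the sign of `c`, the monomial is `D e P Q`.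
  set D := |c| * τ ^ (b + g) with hD
  have hD0 : 0 ≤ D := by positivity
  obtain ⟨e, he, hce⟩ : ∃ e : ℝ, e * e = 1 ∧ c = e * |c| := by
    rcases le_total 0 c with hc | hc
    · exact ⟨1, by norm_num, by rw [abs_of_nonneg hc, one_mul]⟩
    · exact ⟨-1, by norm_num, by rw [abs_of_nonpos hc]; ring⟩
  have hmon : monomial (β + γ) c = C D * (C e * P * Q) := by
    rw [hP, hQ, mul_assoc (C e), monomial_mul, C_mul_monomial, C_mul_monomial]
    congr 1
    rw [hD, ← pow_add, inv_pow]
    have : τ ^ (b + g) ≠ 0 := by positivity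
    field_simp
    linarith
  set B := barrier n h τ⁻¹ with hB
  have hτD : 0 ≤ |c| * τ - D := by
    have : τ ^ (b + g) ≤ τ := by
      calc τ ^ (b + g) ≤ τ ^ 1 := pow_le_pow_of_le_one hτ.le hτ1 hα
        _ = τ := pow_one τ
    rw [hD, ← mul_sub]
    exact mul_nonneg (abs_nonneg c) (sub_nonneg.2 this)
  have hBsq : IsSumSq B := isSumSq_barrier _
  -- `h2` and `h4` add up to `D (B I - P² E_ii)`, and `h3` and `h5` to `D (B I - Q² E_jj)`. The
  -- square `h6` restores the two subtracted terms and produces the cross terms; `h1` fills the gap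
  -- between `2 D` and `2 |c| τ`. The case `i = j` needs no separate treatment.
  have h1 := isSOSMatrix_smul_one (n := n)
    ((isSumSq_C (n := n) (mul_nonneg zero_le_two hτD)).mul hBsq)
  have h2 := (isSOSMatrix_smul_one_sub_single hBsq i).smul (isSumSq_C hD0)
  have h3 := (isSOSMatrix_smul_one_sub_single hBsq j).smul (isSumSq_C hD0)
  have h4 := (isSOSMatrix_single (isSumSq_one_add_sub_monomial β hβh τ⁻¹) i).smul (isSumSq_C hD0)
  have h5 := (isSOSMatrix_single (isSumSq_one_add_sub_monomial γ hγh τ⁻¹) j).smul (isSumSq_C hD0)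
  have h6 := (isSOSMatrix_vecMulVec (Pi.single i P + Pi.single j (C e * Q))).smul (isSumSq_C hD0)
  convert! ((((h1.add h2).add h3).add h4).add h5).add h6 using 1
  have hCe : (C e : MvPolynomial (Fin n) ℝ) * C e = 1 := by rw [← C_mul, he, C_1]
  have hsing : ∀ (k l : Fin n) (a : MvPolynomial (Fin n) ℝ),
      Matrix.single k l a = a • Matrix.single k l 1 := fun k l a => by
    rw [Matrix.smul_single, smul_eq_mul, mul_one]
  have hvec : ∀ (k l : Fin n) (a b : MvPolynomial (Fin n) ℝ),
      Matrix.vecMulVec (Pi.single k a) (Pi.single l b) = (a * b) • Matrix.single k l 1 :=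
    fun k l a b => by
      ext x y : 2
      rw [Matrix.vecMulVec_apply, Matrix.smul_apply, Matrix.single_apply]
      by_cases hk : k = x
      · by_cases hl : l = y
        · subst hk hl; simp
        · simp [hl]
      · simp [hk]
  have hBβ : 1 + (C (τ⁻¹ ^ 2) * normSqPoly n) ^ h - (monomial β) (τ⁻¹ ^ β.degree) ^ 2 =
      B - P ^ 2 := rfl
  have hBγ : 1 + (C (τ⁻¹ ^ 2) * normSqPoly n) ^ h - (monomial γ) (τ⁻¹ ^ γ.degree) ^ 2 =
      B - Q ^ 2 := rfl
  have hQQ : C e * Q * (C e * Q) = Q ^ 2 := by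
    linear_combination Q ^ 2 * hCe
  have hC : (C (2 * |c| * τ) : MvPolynomial (Fin n) ℝ) = C (2 * (|c| * τ - D)) + C D + C D := by
    rw [← C_add, ← C_add]
    congr 1
    ring
  rw [hmon, hBβ, hBγ, Matrix.add_vecMulVec, Matrix.vecMulVec_add, Matrix.vecMulVec_add,
    hvec, hvec, hvec, hvec, hQQ, hC, hsing i j, hsing j i, hsing i i B, hsing j j B,
    hsing i i (B - P ^ 2), hsing j j (B - Q ^ 2)]
  module

end Dominated

/-! ### Hessians of polynomials -/

section Hessian

variable {n : ℕ}

theorem pderiv_comm {σ R : Type*} [CommSemiring R] (i j : σ) (q : MvPolynomial σ R) :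
    pderiv i (pderiv j q) = pderiv j (pderiv i q) := by
  classical
  ext m
  simp only [coeff_pderiv, Finsupp.add_apply, Finsupp.single_apply, add_right_comm m]
  split_ifs with h1 h2 h2
  · subst h1; ring
  · exact absurd h1.symm h2
  · exact absurd h2.symm h1
  · ring_nf

theorem polyHessian_apply (q : MvPolynomial (Fin n) ℝ) (i j : Fin n) :
    polyHessian q i j = pderiv i (pderiv j q) := rfl

theorem polyHessian_add (q r : MvPolynomial (Fin n) ℝ) :
    polyHessian (q + r) = polyHessian q + polyHessian r := by
  ext i j : 1
  simp [polyHessian_apply]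

theorem polyHessian_sum {ι : Type*} (s : Finset ι) (q : ι → MvPolynomial (Fin n) ℝ) :
    polyHessian (∑ k ∈ s, q k) = ∑ k ∈ s, polyHessian (q k) := by
  ext i j : 1
  simp [polyHessian_apply, Matrix.sum_apply]

theorem polyHessian_C_mul (c : ℝ) (q : MvPolynomial (Fin n) ℝ) :
    polyHessian (C c * q) = (C c : MvPolynomial (Fin n) ℝ) • polyHessian q := by
  ext i j : 1
  simp [polyHessian_apply]

theorem polyHessian_monomial_apply (α : Fin n →₀ ℕ) (c : ℝ) (i j : Fin n) :
    polyHessian (monomial α c) i j =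
      monomial (α - Finsupp.single j 1 - Finsupp.single i 1)
        (c * α j * ((α - Finsupp.single j 1 : Fin n →₀ ℕ) i : ℝ)) := by
  rw [polyHessian_apply, pderiv_monomial, pderiv_monomial]

theorem sub_single_degree {σ : Type*} {α : σ →₀ ℕ} {i : σ} (h : α i ≠ 0) :
    (α - Finsupp.single i 1).degree + 1 = α.degree := by
  have hle : Finsupp.single i 1 ≤ α := by
    rw [Finsupp.single_le_iff]
    exact Nat.one_le_iff_ne_zero.2 h
  conv_rhs => rw [← tsub_add_cancel_of_le hle]
  simp

theorem polyHessian_monomial_of_degree_le_one {α : Fin n →₀ ℕ} (hα : α.degree ≤ 1) (c : ℝ) :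
    polyHessian (monomial α c) = 0 := by
  ext i j : 1
  rw [polyHessian_monomial_apply]
  rcases eq_or_ne (α j) 0 with hj | hj
  · simp [hj]
  · have h1 := sub_single_degree hj
    have h2 : α - Finsupp.single j 1 = 0 := by
      rw [← Finsupp.degree_eq_zero_iff]
      omega
    simp [h2]

/-- Symmetry of the Hessian allows its entries to be paired as in `isDominated_monomial`. Their
degrees lie between `1` and `p - 2 ≤ 2 (p / 2)`. The constant counts `n²` pairs, with
differentiation factors at most `p²`. -/
theorem isDominated_polyHessian_monomial {p : ℕ} {α : Fin n →₀ ℕ} (hα : 3 ≤ α.degree)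
    (hαp : α.degree ≤ p) (c : ℝ) :
    IsDominated (p / 2) ((n : ℝ) ^ 2 * (p : ℝ) ^ 2 * |c|) (polyHessian (monomial α c)) := by
  set M := polyHessian (monomial α c) with hM
  have hsymm : ∀ i j, M i j = M j i := fun i j => pderiv_comm i j _
  have hdec : M = ∑ i, ∑ j, (Matrix.single i j (C (1 / 2) * M i j) +
      Matrix.single j i (C (1 / 2) * M i j)) := by
    have h1 : ∑ i, ∑ j, Matrix.single i j (C (1 / 2) * M i j) =
        (C (1 / 2) : MvPolynomial (Fin n) ℝ) • M := by
      conv_rhs => rw [Matrix.matrix_eq_sum_single M]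
      simp only [Finset.smul_sum, Matrix.smul_single, smul_eq_mul]
    have h2 : ∑ i, ∑ j, Matrix.single j i (C (1 / 2) * M i j) =
        (C (1 / 2) : MvPolynomial (Fin n) ℝ) • M := by
      rw [Finset.sum_comm, ← h1]
      simp only [hsymm]
    simp only [Finset.sum_add_distrib]
    rw [h1, h2, ← add_smul, ← C_add]
    norm_num
  have hterm : ∀ i j, IsDominated (p / 2) ((p : ℝ) ^ 2 * |c|)
      (Matrix.single i j (C (1 / 2) * M i j) + Matrix.single j i (C (1 / 2) * M i j)) := by
    intro i j
    rw [hM, polyHessian_monomial_apply, C_mul_monomial]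
    rcases eq_or_ne (α j) 0 with hj | hj
    · simpa [hj] using isDominated_zero (by positivity)
    have h1 := sub_single_degree hj
    set β := α - Finsupp.single j 1
    rcases eq_or_ne (β i) 0 with hi | hi
    · simpa [hi] using isDominated_zero (by positivity)
    have h2 := sub_single_degree hi
    refine (isDominated_monomial (h := p / 2) (by omega) (by omega) i j _).mono ?_
    have hαj : (α j : ℝ) ≤ p := by exact_mod_cast (Finsupp.le_degree j α).trans hαp
    have hβi : (β i : ℝ) ≤ p := by
      have := Finsupp.le_degree i β
      exact_mod_cast (by omega : β i ≤ p)
    rw [abs_mul, abs_mul, abs_mul, Nat.abs_cast, Nat.abs_cast, abs_of_pos (by norm_num)]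
    calc 2 * (1 / 2 * (|c| * (α j : ℝ) * (β i : ℝ))) = |c| * ((α j : ℝ) * (β i : ℝ)) := by ring
      _ ≤ |c| * ((p : ℝ) * p) := by gcongr
      _ = _ := by ring
  rw [hdec]
  refine (IsDominated.sum fun i _ => IsDominated.sum fun j _ => hterm i j).mono ?_
  simp only [Finset.sum_const, Finset.card_univ, Fintype.card_fin, nsmul_eq_mul]
  exact le_of_eq (by ring)

/-- For `h = 0` the truncated exponent `h - 1` is harmless, because its coefficient vanishes. -/
theorem polyHessian_normSqPoly_pow (h : ℕ) :
    polyHessian (normSqPoly n ^ (h + 1)) =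
      (C (2 * ((h : ℝ) + 1)) * normSqPoly n ^ h) • (1 : Matrix (Fin n) (Fin n) (MvPolynomial (Fin n) ℝ)) +
      (C (4 * (h : ℝ) * ((h : ℝ) + 1)) * normSqPoly n ^ (h - 1)) •
        Matrix.vecMulVec (X : Fin n → MvPolynomial (Fin n) ℝ) X := by
  have h2 : (C 2 : MvPolynomial (Fin n) ℝ) = 2 := map_ofNat C 2
  have h4 : (C 4 : MvPolynomial (Fin n) ℝ) = 4 := map_ofNat C 4
  have hd : ∀ i, pderiv i (normSqPoly n) = C (2 : ℝ) * (X i : MvPolynomial (Fin n) ℝ) := by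
    intro i
    simp only [normSqPoly, map_sum, pderiv_pow, pderiv_X]
    rw [Finset.sum_eq_single i (fun j _ hj => by simp [Pi.single_eq_of_ne hj]) (by simp)]
    simpa using h2.symm
  ext i j : 1
  rw [polyHessian_apply, pderiv_pow, hd, pderiv_mul, pderiv_mul, pderiv_mul, pderiv_pow, hd,
    pderiv_C, pderiv_X]
  simp only [Nat.cast_add, Nat.cast_one, Nat.add_sub_cancel, Matrix.add_apply, Matrix.smul_apply,
    Matrix.vecMulVec_apply, smul_eq_mul, Matrix.one_apply, C_mul, C_add]
  rw [← map_natCast (C : ℝ →+* MvPolynomial (Fin n) ℝ) h]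
  rcases eq_or_ne i j with rfl | hij
  · simp [h2, h4]
    ring
  · simp [hij, h2, h4]
    ring

end Hessian

end ARpSoS

end

noncomputable section

namespace ARpSoS

open MvPolynomial

/-! ### The smallest eigenvalue of the Hessian -/

section LamMin

variable {n : ℕ} {f : EuclideanSpace ℝ (Fin n) → ℝ}

/-- Expansion of a multilinear map on the diagonal in coordinates. -/
theorem multilinear_diag_eq_sum {j : ℕ}
    (A : ContinuousMultilinearMap ℝ (fun _ : Fin j => EuclideanSpace ℝ (Fin n)) ℝ)
    (s : EuclideanSpace ℝ (Fin n)) :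
    A (fun _ => s) = ∑ i : Fin j → Fin n,
      (∏ k, s (i k)) * A (fun k => EuclideanSpace.single (i k) 1) := by
  have hs : s = ∑ i, s i • EuclideanSpace.single i (1 : ℝ) := by
    ext k
    simp [Pi.single_apply]
  conv_lhs => rw [hs]
  rw [A.map_sum]
  refine Finset.sum_congr rfl fun i _ => ?_
  rw [A.map_smul_univ, smul_eq_mul]

theorem hessian_isHermitian (hf : ContDiff ℝ 2 f) (x : EuclideanSpace ℝ (Fin n)) :
    (hessian f x).IsHermitian := by
  refine Matrix.IsHermitian.ext fun i j => ?_
  have h : IsSymmSndFDerivAt ℝ f x := (hf.contDiffAt).isSymmSndFDerivAt (by simp)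
  simp only [hessian, Matrix.of_apply, star_trivial, iteratedFDeriv_two_apply, Matrix.cons_val_zero,
    Matrix.cons_val_one]
  exact h _ _

theorem iteratedFDeriv_two_diag (x s : EuclideanSpace ℝ (Fin n)) :
    iteratedFDeriv ℝ 2 f x (fun _ => s) = s.ofLp ⬝ᵥ (hessian f x).mulVec s.ofLp := by
  rw [multilinear_diag_eq_sum, ← (finTwoArrowEquiv (Fin n)).symm.sum_comp, Fintype.sum_prod_type]
  simp only [dotProduct, Matrix.mulVec, Finset.mul_sum, finTwoArrowEquiv_symm_apply,
    Fin.prod_univ_two, Matrix.cons_val_zero, Matrix.cons_val_one, hessian, Matrix.of_apply]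
  refine Finset.sum_congr rfl fun i _ => Finset.sum_congr rfl fun j _ => ?_
  have : (fun k => EuclideanSpace.single (![i, j] k) (1 : ℝ)) =
      ![EuclideanSpace.single i 1, EuclideanSpace.single j 1] := by
    funext k
    fin_cases k <;> rfl
  rw [this]
  ring

theorem posSemidef_hessian_sub_lamMin (hf : ContDiff ℝ 2 f) (x : EuclideanSpace ℝ (Fin n)) {c : ℝ}
    (hc : c ≤ lamMin f x) : (hessian f x - c • (1 : Matrix (Fin n) (Fin n) ℝ)).PosSemidef := by
  have hH := hessian_isHermitian hf x
  rw [Matrix.posSemidef_iff_isHermitian_and_spectrum_nonneg]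
  refine ⟨hH.sub (by simp [Matrix.IsHermitian]), ?_⟩
  intro y hy
  have hy' : y + c ∈ spectrum ℝ (hessian f x) := by
    have h := spectrum.sub_singleton_eq (hessian f x) c
    rw [Algebra.algebraMap_eq_smul_one] at h
    rw [← h] at hy
    obtain ⟨a, ha, b, hb, hab⟩ := hy
    rw [Set.mem_singleton_iff] at hb
    have : y + c = a := by rw [← hab, hb]; simp
    rwa [this]
  have hbdd : BddBelow (spectrum ℝ (hessian f x)) := by
    rw [hH.spectrum_real_eq_range_eigenvalues]
    exact (Set.finite_range _).bddBelow
  have : lamMin f x ≤ y + c := csInf_le hbdd hy'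
  simp only [Set.mem_ofPred_eq]
  linarith

theorem neg_norm_le_lamMin (hf : ContDiff ℝ 2 f) (x : EuclideanSpace ℝ (Fin n)) :
    -‖iteratedFDeriv ℝ 2 f x‖ ≤ lamMin f x := by
  have hH := hessian_isHermitian hf x
  rcases (spectrum ℝ (hessian f x)).eq_empty_or_nonempty with he | hne
  -- The spectrum is empty only for `n = 0`; the infimum then takes its default value `0`.
  · rw [lamMin, he, Real.sInf_empty]
    simp
  · refine le_csInf hne fun y hy => ?_
    rw [hH.spectrum_real_eq_range_eigenvalues] at hy
    obtain ⟨i, rfl⟩ := hy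
    have h := hH.eigenvalues_eq i
    have h2 := iteratedFDeriv_two_diag (f := f) x (hH.eigenvectorBasis i)
    simp only [star_trivial, RCLike.re_to_real] at h
    rw [h, ← h2]
    have h3 := (iteratedFDeriv ℝ 2 f x).le_opNorm (fun _ => hH.eigenvectorBasis i)
    simp only [Finset.prod_const, hH.eigenvectorBasis.norm_eq_one, one_pow, mul_one,
      Real.norm_eq_abs] at h3
    exact (abs_le.1 h3).1

theorem le_lamMin_add_perturbation (δ l : ℝ) : δ ≤ l + perturbation δ l := by
  unfold perturbation
  split_ifs <;> linarith

theorem perturbation_nonneg {δ l : ℝ} (_ : 0 ≤ δ) : 0 ≤ perturbation δ l := by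
  unfold perturbation
  split_ifs <;> linarith

theorem perturbation_le {δ l C : ℝ} (hδ1 : δ ≤ 1) (hC : 0 ≤ C) (hl : -C ≤ l) :
    perturbation δ l ≤ C + 1 := by
  unfold perturbation
  split_ifs <;> linarith

/-- In all three regimes the perturbation raises the smallest eigenvalue to at least `δ`. -/
theorem posSemidef_hessian_add_perturbation (hf : ContDiff ℝ 2 f) (x : EuclideanSpace ℝ (Fin n))
    (δ : ℝ) : (hessian f x + (perturbation δ (lamMin f x) - δ) •
      (1 : Matrix (Fin n) (Fin n) ℝ)).PosSemidef := by
  have h := posSemidef_hessian_sub_lamMin hf x (c := δ - perturbation δ (lamMin f x))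
    (by linarith [le_lamMin_add_perturbation δ (lamMin f x)])
  rwa [sub_eq_add_neg, ← neg_smul, neg_sub] at h

theorem le_iteratedFDeriv_two_add_perturbation (hf : ContDiff ℝ 2 f)
    (x s : EuclideanSpace ℝ (Fin n)) (δ : ℝ) :
    δ * ‖s‖ ^ 2 ≤
      iteratedFDeriv ℝ 2 f x (fun _ => s) + perturbation δ (lamMin f x) * ‖s‖ ^ 2 := by
  have h := (posSemidef_hessian_add_perturbation hf x δ).dotProduct_mulVec_nonneg s.ofLp
  rw [star_trivial, Matrix.add_mulVec, dotProduct_add, ← iteratedFDeriv_two_diag, Matrix.smul_mulVec,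
    Matrix.one_mulVec, dotProduct_smul, smul_eq_mul] at h
  have : s.ofLp ⬝ᵥ s.ofLp = ‖s‖ ^ 2 := by
    rw [EuclideanSpace.norm_sq_eq]
    simp [dotProduct, sq]
  rw [this] at h
  linarith

end LamMin

/-! ### The model as a polynomial -/

section Model

variable {n : ℕ} {f : EuclideanSpace ℝ (Fin n) → ℝ}

/-- The polynomial `s ↦ A(s, …, s)`. -/
def multilinearPoly {j : ℕ}
    (A : ContinuousMultilinearMap ℝ (fun _ : Fin j => EuclideanSpace ℝ (Fin n)) ℝ) :
    MvPolynomial (Fin n) ℝ :=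
  ∑ i : Fin j → Fin n,
    monomial (∑ k, Finsupp.single (i k) 1) (A fun k => EuclideanSpace.single (i k) 1)

theorem eval_multilinearPoly {j : ℕ}
    (A : ContinuousMultilinearMap ℝ (fun _ : Fin j => EuclideanSpace ℝ (Fin n)) ℝ)
    (s : EuclideanSpace ℝ (Fin n)) :
    eval (fun i => s i) (multilinearPoly A) = A (fun _ => s) := by
  rw [multilinear_diag_eq_sum, multilinearPoly, map_sum]
  refine Finset.sum_congr rfl fun i _ => ?_
  rw [monomial_sum_index, map_mul, map_prod, eval_C, mul_comm]
  simp [eval_monomial]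

theorem degree_sum_single {j : ℕ} (i : Fin j → Fin n) :
    (∑ k, Finsupp.single (i k) 1 : Fin n →₀ ℕ).degree = j := by
  simp [map_sum]

theorem norm_apply_single_le {j : ℕ}
    (A : ContinuousMultilinearMap ℝ (fun _ : Fin j => EuclideanSpace ℝ (Fin n)) ℝ)
    (i : Fin j → Fin n) : |A fun k => EuclideanSpace.single (i k) 1| ≤ ‖A‖ := by
  simpa using A.le_opNorm fun k => EuclideanSpace.single (i k) (1 : ℝ)

theorem isDominated_polyHessian_multilinearPoly {p j : ℕ} (hj : 3 ≤ j) (hjp : j ≤ p)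
    (A : ContinuousMultilinearMap ℝ (fun _ : Fin j => EuclideanSpace ℝ (Fin n)) ℝ) {c : ℝ}
    (hc : |c| ≤ 1) :
    IsDominated (p / 2) ((n : ℝ) ^ j * ((n : ℝ) ^ 2 * (p : ℝ) ^ 2 * ‖A‖))
      (polyHessian (C c * multilinearPoly A)) := by
  rw [multilinearPoly, Finset.mul_sum, polyHessian_sum]
  refine (IsDominated.sum (K := fun _ => (n : ℝ) ^ 2 * (p : ℝ) ^ 2 * ‖A‖) fun i _ => ?_).mono
    (le_of_eq (by simp))
  rw [C_mul_monomial]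
  refine (isDominated_polyHessian_monomial (by rwa [degree_sum_single])
    (by rwa [degree_sum_single]) _).mono ?_
  rw [abs_mul]
  have := norm_apply_single_le A i
  gcongr
  calc |c| * _ ≤ 1 * ‖A‖ := by gcongr
    _ = ‖A‖ := one_mul _

theorem polyHessian_multilinearPoly_of_le_one {j : ℕ} (hj : j ≤ 1)
    (A : ContinuousMultilinearMap ℝ (fun _ : Fin j => EuclideanSpace ℝ (Fin n)) ℝ) :
    polyHessian (multilinearPoly A) = 0 := by
  rw [multilinearPoly, polyHessian_sum]
  exact Finset.sum_eq_zero fun i _ =>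
    polyHessian_monomial_of_degree_le_one (by rwa [degree_sum_single]) _

theorem polyHessian_multilinearPoly_two (hf : ContDiff ℝ 2 f) (x : EuclideanSpace ℝ (Fin n)) :
    polyHessian (C (1 / 2) * multilinearPoly (iteratedFDeriv ℝ 2 f x)) =
      (hessian f x).map (C : ℝ →+* MvPolynomial (Fin n) ℝ) := by
  have hpoly : multilinearPoly (iteratedFDeriv ℝ 2 f x) =
      ∑ a, ∑ b, C (hessian f x a b) * (X a * X b) := by
    rw [multilinearPoly, ← (finTwoArrowEquiv (Fin n)).symm.sum_comp, Fintype.sum_prod_type]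
    refine Finset.sum_congr rfl fun a _ => Finset.sum_congr rfl fun b _ => ?_
    have : (fun k => EuclideanSpace.single (![a, b] k) (1 : ℝ)) =
        ![EuclideanSpace.single a 1, EuclideanSpace.single b 1] := by
      funext k
      fin_cases k <;> rfl
    simp only [finTwoArrowEquiv_symm_apply, this, Fin.sum_univ_two, Matrix.cons_val_zero,
      Matrix.cons_val_one, hessian, Matrix.of_apply, X, monomial_mul, C_mul_monomial, mul_one]
  ext i j : 1
  have hsymm : hessian f x j i = hessian f x i j := by
    simpa using (hessian_isHermitian hf x).apply i j
  rw [hpoly, polyHessian_C_mul, Matrix.smul_apply, polyHessian_apply]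
  simp only [map_sum, pderiv_C_mul, Matrix.map_apply]
  have h1 : ∀ a b k : Fin n, pderiv k (if b = a then (1 : MvPolynomial (Fin n) ℝ) else 0) = 0 :=
    fun a b k => by split_ifs <;> simp
  simp only [map_add, pderiv_mul, pderiv_X, Pi.single_apply, h1, zero_mul, mul_zero, add_zero,
    zero_add, mul_add, Finset.sum_add_distrib]
  simp only [mul_ite, mul_one, mul_zero, Finset.sum_ite_eq', Finset.mem_univ, if_true]
  rw [hsymm, smul_eq_mul, ← C_add, ← C_mul]
  congr 1
  ring

theorem regOrder_eq (p : ℕ) : regOrder p = 2 * (p / 2 + 1) := by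
  unfold regOrder
  split_ifs with h
  · obtain ⟨k, rfl⟩ := h
    omega
  · obtain ⟨k, rfl⟩ := Nat.not_odd_iff_even.1 h
    omega

theorem taylorModel_eq_taylorPoly (p : ℕ) (x s : EuclideanSpace ℝ (Fin n)) :
    taylorModel f p x s = taylorPoly f p x s := by
  rw [taylorModel, taylorPoly, Finset.range_eq_Ico, Finset.sum_eq_sum_Ico_succ_bot (by omega)]
  simp only [Nat.factorial_zero, Nat.cast_one, div_one, iteratedFDeriv_zero_apply,
    smul_eq_mul, one_mul]
  rfl

/-- The model `m_c(x, ·)` as a polynomial. -/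
def modelPoly (f : EuclideanSpace ℝ (Fin n) → ℝ) (p : ℕ) (δ σ : ℝ)
    (x : EuclideanSpace ℝ (Fin n)) : MvPolynomial (Fin n) ℝ :=
  ∑ j ∈ Finset.range (p + 1),
      C (1 / (j.factorial : ℝ)) * multilinearPoly (iteratedFDeriv ℝ j f x) +
    C (perturbation δ (lamMin f x) / 2) * normSqPoly n ^ (0 + 1) +
    C (σ / (regOrder p : ℝ)) * normSqPoly n ^ (p / 2 + 1)

theorem eval_modelPoly (p : ℕ) (δ σ : ℝ) (x s : EuclideanSpace ℝ (Fin n)) :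
    eval (fun i => s i) (modelPoly f p δ σ x) = sosModel f p δ σ x s := by
  simp only [modelPoly, map_add, map_sum, map_mul, eval_C, eval_multilinearPoly, map_pow,
    eval_normSqPoly]
  rw [sosModel, taylorModel_eq_taylorPoly, taylorPoly, regOrder_eq, ← pow_mul, zero_add, ← pow_mul,
    mul_one]
  simp

theorem polyHessian_reg (p : ℕ) (σ : ℝ) :
    polyHessian (C (σ / (regOrder p : ℝ)) * normSqPoly n ^ (p / 2 + 1)) =
      (C σ * normSqPoly n ^ (p / 2)) • (1 : Matrix (Fin n) (Fin n) (MvPolynomial (Fin n) ℝ)) +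
      (C (2 * ((p / 2 : ℕ) : ℝ) * σ) * normSqPoly n ^ (p / 2 - 1)) •
        Matrix.vecMulVec (X : Fin n → MvPolynomial (Fin n) ℝ) X := by
  have hk : ((p / 2 : ℕ) : ℝ) + 1 ≠ 0 := by positivity
  have h1 : σ / ((2 * (p / 2 + 1) : ℕ) : ℝ) * (2 * (((p / 2 : ℕ) : ℝ) + 1)) = σ := by
    push_cast
    field_simp
  have h2 : σ / ((2 * (p / 2 + 1) : ℕ) : ℝ) *
      (4 * ((p / 2 : ℕ) : ℝ) * (((p / 2 : ℕ) : ℝ) + 1)) = 2 * ((p / 2 : ℕ) : ℝ) * σ := by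
    push_cast
    field_simp
    ring
  rw [polyHessian_C_mul, polyHessian_normSqPoly_pow, smul_add, smul_smul, smul_smul, ← mul_assoc,
    ← mul_assoc, ← C_mul, ← C_mul, regOrder_eq, h1, h2]

theorem isSOSMatrix_polyHessian_reg (p : ℕ) {σ : ℝ} (hσ : 0 ≤ σ) :
    IsSOSMatrix (polyHessian (C (σ / (regOrder p : ℝ)) * normSqPoly n ^ (p / 2 + 1))) := by
  rw [polyHessian_reg]
  exact (isSOSMatrix_smul_one ((isSumSq_C hσ).mul (isSumSq_pow isSumSq_normSqPoly _))).add
    ((isSOSMatrix_vecMulVec _).smul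
      ((isSumSq_C (by positivity)).mul (isSumSq_pow isSumSq_normSqPoly _)))

/-- SoS-convexity of the model is preserved when the regularization parameter grows. -/
theorem IsSOSConvex.sosModel_mono {p : ℕ} {δ σ σ' : ℝ} {x : EuclideanSpace ℝ (Fin n)}
    (h : IsSOSConvex (sosModel f p δ σ x)) (hσ : σ ≤ σ') :
    IsSOSConvex (sosModel f p δ σ' x) := by
  obtain ⟨q, hq, hH⟩ := h
  refine ⟨q + C ((σ' - σ) / (regOrder p : ℝ)) * normSqPoly n ^ (p / 2 + 1), fun s => ?_, ?_⟩
  · rw [map_add, hq, map_mul, eval_C, map_pow, eval_normSqPoly, ← pow_mul, ← regOrder_eq, sosModel,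
      sosModel]
    ring
  · rw [polyHessian_add]
    exact hH.add (isSOSMatrix_polyHessian_reg p (sub_nonneg.2 hσ))

/-- The model is SoS-convex as soon as the regularization parameter is of the order
`δ ^ (1 - 2 h)` where `2 h + 2` is the order of the regularization. -/
theorem isSOSConvex_sosModel {p : ℕ} (hp : 2 ≤ p) (hf : ContDiff ℝ p f) {δ K : ℝ} (hδ : 0 < δ)
    (x : EuclideanSpace ℝ (Fin n)) (hδK : δ ≤ K)
    (hK : ∑ j ∈ Finset.Ico 3 (p + 1),
      (n : ℝ) ^ j * ((n : ℝ) ^ 2 * (p : ℝ) ^ 2 * ‖iteratedFDeriv ℝ j f x‖) ≤ K) :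
    IsSOSConvex (sosModel f p δ (δ * (K / δ) ^ (2 * (p / 2))) x) := by
  set σ := δ * (K / δ) ^ (2 * (p / 2)) with hσ
  have hK0 : 0 < K := hδ.trans_le hδK
  have hσ0 : 0 ≤ σ := by positivity
  refine ⟨modelPoly f p δ σ x, eval_modelPoly p δ σ x, ?_⟩
  have hf2 : ContDiff ℝ 2 f := hf.of_le (by exact_mod_cast hp)
  have hdom : IsDominated (p / 2) K (∑ j ∈ Finset.Ico 3 (p + 1),
      polyHessian (C (1 / (j.factorial : ℝ)) * multilinearPoly (iteratedFDeriv ℝ j f x))) := by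
    refine (IsDominated.sum fun j hj => isDominated_polyHessian_multilinearPoly
      (Finset.mem_Ico.1 hj).1 (Nat.lt_succ_iff.1 (Finset.mem_Ico.1 hj).2) _ ?_).mono hK
    rw [abs_of_nonneg (by positivity), div_le_one (by positivity)]
    exact_mod_cast Nat.one_le_iff_ne_zero.2 j.factorial_ne_zero
  -- At the scale `τ = δ / K` the constant part of the barrier is `K τ = δ`, exactly what the
  -- perturbed Hessian can spare, and the coefficient of its top power is exactly `σ`.
  have h1 := hdom (δ / K) (by positivity) ((div_le_one hK0).2 hδK)
  have hsplit : polyHessian (modelPoly f p δ σ x) =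
      (hessian f x + (perturbation δ (lamMin f x) - δ) •
        (1 : Matrix (Fin n) (Fin n) ℝ)).map (C : ℝ →+* MvPolynomial (Fin n) ℝ) +
      ((C (K * (δ / K)) * barrier n (p / 2) (δ / K)⁻¹) •
        (1 : Matrix (Fin n) (Fin n) (MvPolynomial (Fin n) ℝ)) +
        ∑ j ∈ Finset.Ico 3 (p + 1),
          polyHessian (C (1 / (j.factorial : ℝ)) * multilinearPoly (iteratedFDeriv ℝ j f x))) +
      (C (2 * ((p / 2 : ℕ) : ℝ) * σ) * normSqPoly n ^ (p / 2 - 1)) •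
        Matrix.vecMulVec (X : Fin n → MvPolynomial (Fin n) ℝ) X := by
    have hbar : C (K * (δ / K)) * barrier n (p / 2) (δ / K)⁻¹ =
        C δ + C σ * normSqPoly n ^ (p / 2) := by
      rw [barrier, mul_div_cancel₀ _ hK0.ne', mul_add, mul_one, mul_pow, ← C_pow, ← mul_assoc,
        ← C_mul, hσ, inv_div, ← pow_mul]
    have hmap : (hessian f x + (perturbation δ (lamMin f x) - δ) •
        (1 : Matrix (Fin n) (Fin n) ℝ)).map (C : ℝ →+* MvPolynomial (Fin n) ℝ) =
        (hessian f x).map (C : ℝ →+* MvPolynomial (Fin n) ℝ) +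
        (C (perturbation δ (lamMin f x)) - C δ : MvPolynomial (Fin n) ℝ) •
          (1 : Matrix (Fin n) (Fin n) (MvPolynomial (Fin n) ℝ)) := by
      ext i j : 1
      rcases eq_or_ne i j with rfl | hij
      · simp
      · simp [hij]
    rw [modelPoly, polyHessian_add, polyHessian_add, polyHessian_reg, polyHessian_sum,
      polyHessian_C_mul (perturbation δ (lamMin f x) / 2), polyHessian_normSqPoly_pow, hbar, hmap,
      Finset.range_eq_Ico, Finset.sum_eq_sum_Ico_succ_bot (by omega),
      Finset.sum_eq_sum_Ico_succ_bot (by omega), Finset.sum_eq_sum_Ico_succ_bot (by omega)]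
    have h0 := polyHessian_multilinearPoly_of_le_one zero_le_one (iteratedFDeriv ℝ 0 f x)
    have h1 := polyHessian_multilinearPoly_of_le_one le_rfl (iteratedFDeriv ℝ 1 f x)
    have h2 := polyHessian_multilinearPoly_two hf2 x
    have h3 : (C (perturbation δ (lamMin f x) / 2) : MvPolynomial (Fin n) ℝ) *
        C (2 * (((0 : ℕ) : ℝ) + 1)) = C (perturbation δ (lamMin f x)) := by
      rw [← C_mul]
      congr 1
      push_cast
      ring
    simp only [zero_add, one_add_one_eq_two, Nat.factorial_two, Nat.cast_two, h2,
      polyHessian_C_mul _ (multilinearPoly (iteratedFDeriv ℝ 0 f x)),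
      polyHessian_C_mul _ (multilinearPoly (iteratedFDeriv ℝ 1 f x)), h0, h1, smul_zero]
    have h4 : (C (4 * ((0 : ℕ) : ℝ) * (((0 : ℕ) : ℝ) + 1)) : MvPolynomial (Fin n) ℝ) = 0 := by simp
    rw [pow_zero, mul_one, smul_add, smul_smul, h3, h4, zero_mul, zero_smul, smul_zero]
    simp only [Nat.reduceAdd]
    module
  rw [hsplit]
  exact ((isSOSMatrix_map_C (posSemidef_hessian_add_perturbation hf2 x δ)).add h1).add
    ((isSOSMatrix_vecMulVec _).smul
      ((isSumSq_C (by positivity)).mul (isSumSq_pow isSumSq_normSqPoly _)))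

end Model

end ARpSoS

end

noncomputable section

namespace ARpSoS

open MvPolynomial

/-! ### Convexity along rays -/

section Ray

variable {n : ℕ}

theorem hasDerivAt_eval_ray (q : MvPolynomial (Fin n) ℝ) (s : Fin n → ℝ) (u : ℝ) :
    HasDerivAt (fun u : ℝ => eval (fun i => u * s i) q)
      (∑ i, s i * eval (fun i => u * s i) (pderiv i q)) u := by
  classical
  induction q using MvPolynomial.induction_on with
  | C a => simpa using hasDerivAt_const u a
  | add q r hq hr =>
    simp only [map_add, mul_add, Finset.sum_add_distrib]
    exact hq.add hr
  | mul_X q i hq =>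
    have hX : HasDerivAt (fun u : ℝ => u * s i) (s i) u := by
      simpa using (hasDerivAt_id u).mul_const (s i)
    have h := hq.mul hX
    convert! h using 1
    · funext u
      simp
    · simp only [pderiv_mul, pderiv_X, map_add, map_mul, eval_X, mul_add, Finset.sum_add_distrib,
        Finset.sum_mul, mul_assoc]
      congr 1
      rw [Finset.sum_eq_single i (fun j _ hj => by simp [Pi.single_eq_of_ne hj.symm]) (by simp)]
      simp [mul_comm]

/-- The second derivative along the ray is `sᵀ Vᵀ V s`, a sum of squares of reals. -/
theorem IsSOSConvex.convexOn_ray {g : EuclideanSpace ℝ (Fin n) → ℝ} (hg : IsSOSConvex g)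
    (s : EuclideanSpace ℝ (Fin n)) : ConvexOn ℝ Set.univ (fun u : ℝ => g (u • s)) := by
  obtain ⟨q, hq, m, V, hV⟩ := hg
  have hgq : (fun u : ℝ => g (u • s)) = fun u => eval (fun i => u * s i) q := by
    funext u
    rw [← hq]
    rfl
  have hd1 : deriv (fun u : ℝ => eval (fun i => u * s i) q) =
      fun u => ∑ i, s i * eval (fun i => u * s i) (pderiv i q) := by
    funext u
    exact (hasDerivAt_eval_ray q s.ofLp u).deriv
  have hd2 : ∀ u : ℝ, HasDerivAt (fun u => ∑ i, s i * eval (fun i => u * s i) (pderiv i q))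
      (∑ i, s i * ∑ j, s j * eval (fun i => u * s i) (pderiv j (pderiv i q))) u := fun u =>
    HasDerivAt.fun_sum fun i _ => (hasDerivAt_eval_ray (pderiv i q) s.ofLp u).const_mul (s i)
  rw [hgq]
  refine convexOn_univ_of_deriv2_nonneg
    (fun u => (hasDerivAt_eval_ray q s.ofLp u).differentiableAt) ?_ fun u => ?_
  · rw [hd1]
    exact fun u => (hd2 u).differentiableAt
  · rw [Function.iterate_succ, Function.iterate_one, Function.comp_apply, hd1, (hd2 u).deriv]
    have hent : ∀ i j, eval (fun i => u * s i) (pderiv j (pderiv i q)) =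
        ∑ k, eval (fun i => u * s i) (V k j) * eval (fun i => u * s i) (V k i) := by
      intro i j
      have h := congrFun (congrFun hV j) i
      rw [polyHessian_apply, Matrix.mul_apply] at h
      rw [h, map_sum]
      simp only [Matrix.transpose_apply, map_mul]
    have : ∑ i, s i * ∑ j, s j * eval (fun i => u * s i) (pderiv j (pderiv i q)) =
        ∑ k, (∑ i, s i * eval (fun i => u * s i) (V k i)) ^ 2 := by
      have hk : ∀ k, (∑ i, s i * eval (fun i => u * s i) (V k i)) ^ 2 =
          ∑ i, ∑ j, s i * (s j *
            (eval (fun i => u * s i) (V k j) * eval (fun i => u * s i) (V k i))) := fun k => by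
        rw [sq, Finset.sum_mul_sum]
        exact Finset.sum_congr rfl fun i _ => Finset.sum_congr rfl fun j _ => by ring
      simp only [hent, hk, Finset.mul_sum]
      rw [Finset.sum_comm (s := Finset.univ (α := Fin m))]
      refine Finset.sum_congr rfl fun i _ => ?_
      rw [Finset.sum_comm]
    rw [this]
    positivity

end Ray

/-! ### Bounds on the Taylor polynomial -/

section TaylorBounds

variable {E G : Type} [NormedAddCommGroup E] [NormedSpace ℝ E]
  [NormedAddCommGroup G] [NormedSpace ℝ G]

theorem norm_taylorPoly_sub_le (F : E → G) {m k : ℕ} (hk : k ≤ m + 1) (x : E) {s : E}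
    (hs : ‖s‖ ≤ 1) :
    ‖taylorPoly F m x s -
      ∑ j ∈ Finset.range k, (1 / (j.factorial : ℝ)) • iteratedFDeriv ℝ j F x (fun _ => s)‖ ≤
      (∑ j ∈ Finset.Ico k (m + 1), ‖iteratedFDeriv ℝ j F x‖) * ‖s‖ ^ k := by
  rw [taylorPoly, ← Finset.sum_range_add_sum_Ico _ hk, add_sub_cancel_left, Finset.sum_mul]
  refine norm_sum_le_of_le _ fun j hj => ?_
  have hkj := (Finset.mem_Ico.1 hj).1
  have h1 : ‖(1 / (j.factorial : ℝ))‖ ≤ 1 := by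
    rw [Real.norm_of_nonneg (by positivity), div_le_one (by positivity)]
    exact_mod_cast Nat.one_le_iff_ne_zero.2 j.factorial_ne_zero
  have h2 : ‖iteratedFDeriv ℝ j F x (fun _ => s)‖ ≤ ‖iteratedFDeriv ℝ j F x‖ * ‖s‖ ^ k := by
    refine ((iteratedFDeriv ℝ j F x).le_opNorm _).trans ?_
    rw [Finset.prod_const, Finset.card_univ, Fintype.card_fin]
    exact mul_le_mul_of_nonneg_left (pow_le_pow_of_le_one (norm_nonneg s) hs hkj) (norm_nonneg _)
  rw [norm_smul]
  calc _ ≤ 1 * (‖iteratedFDeriv ℝ j F x‖ * ‖s‖ ^ k) := by gcongr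
    _ = _ := one_mul _

end TaylorBounds

/-! ### Analysis of a single step -/

section Step

variable {n p : ℕ} {f : EuclideanSpace ℝ (Fin n) → ℝ} {δ σ : ℝ}
  {x s : EuclideanSpace ℝ (Fin n)}

theorem sosModel_zero : sosModel f p δ σ x 0 = f x := by
  rw [sosModel, taylorModel_eq_taylorPoly, taylorPoly_zero_right, regOrder_eq]
  simp

theorem hasFDerivAt_norm_pow (k : ℕ) (s : EuclideanSpace ℝ (Fin n)) :
    HasFDerivAt (fun y : EuclideanSpace ℝ (Fin n) => ‖y‖ ^ (2 * (k + 1)))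
      ((2 * (k + 1) * ‖s‖ ^ (2 * k)) • innerSL ℝ s) s := by
  have h := (hasStrictFDerivAt_norm_sq s).hasFDerivAt.pow (k + 1)
  convert! h using 1
  · funext y
    rw [pow_mul]
  · rw [Nat.add_sub_cancel, ← pow_mul, ← Nat.cast_smul_eq_nsmul ℝ, ← Nat.cast_smul_eq_nsmul ℝ]
    simp only [smul_smul]
    congr 1
    push_cast
    ring

/-- At a minimizer of the model the derivative of the Taylor polynomial is balanced by the
derivatives of the perturbation and of the regularization. -/
theorem norm_taylorPoly_fderiv_le (hp : 1 ≤ p) (hf : ContDiff ℝ p f) (hδ : 0 ≤ δ) (hσ : 0 ≤ σ)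
    (hs : IsMinOn (sosModel f p δ σ x) Set.univ s) :
    ‖taylorPoly (fderiv ℝ f) (p - 1) x s‖ ≤
      perturbation δ (lamMin f x) * ‖s‖ + σ * ‖s‖ ^ (regOrder p - 1) := by
  obtain ⟨m, rfl⟩ := Nat.exists_eq_add_of_le' hp
  rw [Nat.add_sub_cancel]
  set μ := perturbation δ (lamMin f x) with hμ
  have hμ0 : 0 ≤ μ := perturbation_nonneg hδ
  set h := (m + 1) / 2 with hh
  have hreg : regOrder (m + 1) = 2 * (h + 1) := regOrder_eq _
  have hT : HasFDerivAt (sosModel f (m + 1) δ σ x)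
      (taylorPoly (fderiv ℝ f) m x s + (μ / 2) • ((2 * ((0 : ℕ) + 1) * ‖s‖ ^ (2 * 0)) • innerSL ℝ s) +
        (σ / (regOrder (m + 1) : ℝ)) • ((2 * (h + 1) * ‖s‖ ^ (2 * h)) • innerSL ℝ s)) s := by
    have h1 := ((hasFDerivAt_taylorPoly hf x s).add
      ((hasFDerivAt_norm_pow 0 s).const_mul (μ / 2))).add
      ((hasFDerivAt_norm_pow h s).const_mul (σ / (regOrder (m + 1) : ℝ)))
    refine h1.congr_of_eventuallyEq (Filter.Eventually.of_forall fun y => ?_)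
    simp only [sosModel, taylorModel_eq_taylorPoly, hreg, Pi.add_apply]
    rfl
  have h0 := (hs.isLocalMin Filter.univ_mem).hasFDerivAt_eq_zero hT
  have h1 : taylorPoly (fderiv ℝ f) m x s =
      -((μ + σ * ‖s‖ ^ (2 * h)) • innerSL ℝ s) := by
    rw [eq_neg_iff_add_eq_zero, ← h0, hreg, add_smul, smul_smul, smul_smul, ← add_assoc]
    have hne : (h : ℝ) + 1 ≠ 0 := by positivity
    have e1 : μ / 2 * (2 * (((0 : ℕ) : ℝ) + 1) * ‖s‖ ^ (2 * 0)) = μ := by simp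
    have e2 : σ / ((2 * (h + 1) : ℕ) : ℝ) * (2 * ((h : ℝ) + 1) * ‖s‖ ^ (2 * h)) =
        σ * ‖s‖ ^ (2 * h) := by
      push_cast
      field_simp
    rw [e1, e2]
  rw [h1, norm_neg, norm_smul, Real.norm_of_nonneg (by positivity), innerSL_apply_norm, hreg]
  have : 2 * (h + 1) - 1 = 2 * h + 1 := by omega
  rw [this, pow_succ]
  exact le_of_eq (by ring)

theorem le_sub_taylorModel (hs : IsMinOn (sosModel f p δ σ x) Set.univ s) :
    perturbation δ (lamMin f x) / 2 * ‖s‖ ^ 2 + σ / (regOrder p : ℝ) * ‖s‖ ^ regOrder p ≤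
      f x - taylorModel f p x s := by
  have h : sosModel f p δ σ x s ≤ sosModel f p δ σ x 0 := hs (Set.mem_univ 0)
  rw [sosModel_zero, sosModel] at h
  linarith

/-- Any trial point `v` certifies a predicted decrease, as the model lies above the Taylor
polynomial. It is applied at the Cauchy point and at a point of the ray through `s`. -/
theorem sub_sosModel_le (hδ : 0 ≤ δ) (hσ : 0 ≤ σ)
    (hs : IsMinOn (sosModel f p δ σ x) Set.univ s) (v : EuclideanSpace ℝ (Fin n)) :
    f x - sosModel f p δ σ x v ≤ f x - taylorModel f p x s := by
  have h : sosModel f p δ σ x s ≤ sosModel f p δ σ x v := hs (Set.mem_univ v)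
  have hμ0 : 0 ≤ perturbation δ (lamMin f x) := perturbation_nonneg hδ
  have h1 : taylorModel f p x s ≤ sosModel f p δ σ x s := by
    unfold sosModel
    have : 0 ≤ perturbation δ (lamMin f x) / 2 * ‖s‖ ^ 2 := by positivity
    have : 0 ≤ σ / (regOrder p : ℝ) * ‖s‖ ^ regOrder p := by positivity
    linarith
  linarith

variable {L : ℝ}

theorem IsCp1.norm_fderiv_sub_le (hf : IsCp1 p L f) (hp : 1 ≤ p) (hL : 0 ≤ L)
    (x s : EuclideanSpace ℝ (Fin n)) :
    ‖fderiv ℝ f (x + s) - taylorPoly (fderiv ℝ f) (p - 1) x s‖ ≤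
      ((p - 1).factorial * L) * ‖s‖ ^ p := by
  obtain ⟨m, rfl⟩ := Nat.exists_eq_add_of_le' hp
  exact norm_sub_taylorPoly_le (by positivity) (hf.contDiff.fderiv_right (by norm_cast))
    (fun x y => (norm_iteratedFDeriv_fderiv_sub f m x y).trans_le (hf.lipschitz x y)) x s

theorem IsCp1.abs_sub_taylorModel_le (hf : IsCp1 p L f) (hL : 0 ≤ L)
    (x s : EuclideanSpace ℝ (Fin n)) :
    |f (x + s) - taylorModel f p x s| ≤ ((p - 1).factorial * L) * ‖s‖ ^ (p + 1) := by
  rw [taylorModel_eq_taylorPoly]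
  exact norm_sub_taylorPoly_le (by positivity) hf.contDiff hf.lipschitz x s

theorem IsCp1.norm_fderiv_add_le (hf : IsCp1 p L f) (hp : 1 ≤ p) (hL : 0 ≤ L) (hδ : 0 ≤ δ)
    (hσ : 0 ≤ σ) (hs : IsMinOn (sosModel f p δ σ x) Set.univ s) :
    ‖fderiv ℝ f (x + s)‖ ≤ ((p - 1).factorial * L) * ‖s‖ ^ p +
      perturbation δ (lamMin f x) * ‖s‖ + σ * ‖s‖ ^ (regOrder p - 1) := by
  have h1 := hf.norm_fderiv_sub_le hp hL x s
  have h2 := norm_taylorPoly_fderiv_le hp hf.contDiff hδ hσ hs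
  have h3 := norm_sub_norm_le (fderiv ℝ f (x + s)) (taylorPoly (fderiv ℝ f) (p - 1) x s)
  linarith

variable {K : ℝ}

theorem sum_Ico_norm_le (hK : ∑ j ∈ Finset.Icc 1 p, ‖iteratedFDeriv ℝ j f x‖ ≤ K) {k : ℕ}
    (hk : 1 ≤ k) : ∑ j ∈ Finset.Ico k (p + 1), ‖iteratedFDeriv ℝ j f x‖ ≤ K := by
  refine le_trans (Finset.sum_le_sum_of_subset_of_nonneg (fun j hj => ?_)
    fun _ _ _ => norm_nonneg _) hK
  rw [Finset.mem_Ico] at hj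
  rw [Finset.mem_Icc]
  omega

/-- A large gradient at the current point forces a step that is not too short. This is needed after
unsuccessful iterations, where nothing is known about the gradient at the trial point. -/
theorem norm_fderiv_le (hp : 1 ≤ p) (hf : ContDiff ℝ p f) (hδ : 0 ≤ δ) (hσ : 0 ≤ σ)
    (hs : IsMinOn (sosModel f p δ σ x) Set.univ s) (hs1 : ‖s‖ ≤ 1)
    (hK : ∑ j ∈ Finset.Icc 1 p, ‖iteratedFDeriv ℝ j f x‖ ≤ K) :
    ‖fderiv ℝ f x‖ ≤ K * ‖s‖ + perturbation δ (lamMin f x) * ‖s‖ +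
      σ * ‖s‖ ^ (regOrder p - 1) := by
  have h2 := norm_taylorPoly_fderiv_le hp hf hδ hσ hs
  have h3 := norm_taylorPoly_sub_le (fderiv ℝ f) (m := p - 1) (k := 1) (by omega) x hs1
  have h4 : ∑ j ∈ Finset.Ico 1 (p - 1 + 1), ‖iteratedFDeriv ℝ j (fderiv ℝ f) x‖ ≤ K := by
    refine le_trans (le_of_eq ?_) (sum_Ico_norm_le hK (k := 2) (by norm_num))
    simp only [norm_iteratedFDeriv_fderiv]
    rw [Finset.sum_Ico_add' (fun j => ‖iteratedFDeriv ℝ j f x‖), show p - 1 + 1 = p by omega]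
  simp only [Finset.range_one, Finset.sum_singleton, Nat.factorial_zero, Nat.cast_one, div_one,
    one_smul, iteratedFDeriv_zero_apply, pow_one] at h3
  have h5 := norm_sub_norm_le (fderiv ℝ f x) (taylorPoly (fderiv ℝ f) (p - 1) x s)
  rw [norm_sub_rev] at h5
  have h6 := mul_le_mul_of_nonneg_right h4 (norm_nonneg s)
  linarith

/-- Decrease at the Cauchy point. -/
theorem cauchy_decrease (hp : 1 ≤ p) (hδ : 0 ≤ δ) (hσ : 0 ≤ σ)
    (hs : IsMinOn (sosModel f p δ σ x) Set.univ s)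
    (hK : ∑ j ∈ Finset.Icc 1 p, ‖iteratedFDeriv ℝ j f x‖ ≤ K) {r : ℝ} (hr : 0 ≤ r) (hr1 : r ≤ 1)
    (hg : gradient f x ≠ 0) :
    r * ‖gradient f x‖ - (K + perturbation δ (lamMin f x) / 2) * r ^ 2 -
      σ / (regOrder p : ℝ) * r ^ regOrder p ≤ f x - taylorModel f p x s := by
  have hg0 : 0 < ‖gradient f x‖ := norm_pos_iff.2 hg
  set v := -(r / ‖gradient f x‖) • gradient f x with hv
  have hvn : ‖v‖ = r := by
    rw [hv, norm_smul, norm_neg, Real.norm_of_nonneg (by positivity), div_mul_cancel₀ _ hg0.ne']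
  have hdv : fderiv ℝ f x v = -(r * ‖gradient f x‖) := by
    rw [← toDual_gradient, InnerProductSpace.toDual_apply_apply, hv, inner_smul_right,
      real_inner_self_eq_norm_sq]
    field_simp
  refine le_trans ?_ (sub_sosModel_le hδ hσ hs v)
  have h3 := norm_taylorPoly_sub_le f (m := p) (k := 2) (by omega) x (hvn.trans_le hr1)
  have h4 := mul_le_mul_of_nonneg_right (sum_Ico_norm_le hK (k := 2) (by norm_num))
    (sq_nonneg ‖v‖)
  have h5 := (abs_le.1 (h3.trans h4)).2
  rw [Finset.sum_range_succ, Finset.sum_range_one] at h5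
  simp only [Nat.factorial_zero, Nat.factorial_one, Nat.cast_one, div_one, one_smul,
    iteratedFDeriv_zero_apply, iteratedFDeriv_one_apply, hdv, hvn] at h5
  rw [sosModel, taylorModel_eq_taylorPoly, hvn]
  linarith

theorem iteratedFDeriv_smul_diag (j : ℕ) (u : ℝ) :
    iteratedFDeriv ℝ j f x (fun _ => u • s) = u ^ j * iteratedFDeriv ℝ j f x (fun _ => s) := by
  rw [(iteratedFDeriv ℝ j f x).map_smul_univ (fun _ => u) (fun _ => s)]
  simp

/-- Decrease from the strong convexity of the model near the origin. -/
theorem convex_decrease (hp : 2 ≤ p) (hf : ContDiff ℝ p f) (hδ : 0 < δ) (hσ : 0 ≤ σ)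
    (hs : IsMinOn (sosModel f p δ σ x) Set.univ s)
    (hconv : IsSOSConvex (sosModel f p δ σ x))
    (hK : ∑ j ∈ Finset.Icc 1 p, ‖iteratedFDeriv ℝ j f x‖ ≤ K) (hδK : δ ≤ K) :
    δ / 8 * (min ‖s‖ (δ / (32 * K))) ^ 2 ≤ f x - taylorModel f p x s := by
  have hK0 : 0 < K := hδ.trans_le hδK
  have hf2 : ContDiff ℝ 2 f := hf.of_le (by exact_mod_cast hp)
  -- The step is shortened to length `r` so that the cubic Taylor remainder `K r³` is at most `δ r²
  -- / 32`.
  obtain ⟨θ, hθ0, hθ1, hθ⟩ : ∃ θ : ℝ, 0 ≤ θ ∧ θ ≤ 1 ∧ θ * ‖s‖ = min ‖s‖ (δ / (32 * K)) := by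
    rcases (norm_nonneg s).eq_or_lt with h0 | h0
    · refine ⟨0, le_rfl, zero_le_one, ?_⟩
      rw [← h0, zero_mul, min_eq_left (by positivity)]
    · refine ⟨min ‖s‖ (δ / (32 * K)) / ‖s‖, by positivity, ?_, div_mul_cancel₀ _ h0.ne'⟩
      rw [div_le_one h0]
      exact min_le_left _ _
  set r := min ‖s‖ (δ / (32 * K)) with hr
  have hr0 : 0 ≤ r := by positivity
  have hrδ : r * K ≤ δ / 32 := by
    calc r * K ≤ δ / (32 * K) * K := by
          exact mul_le_mul_of_nonneg_right (min_le_right _ _) hK0.le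
      _ = δ / 32 := by field_simp
  have hr1 : r ≤ 1 := by
    by_contra! h
    nlinarith
  set φ : ℝ → ℝ := fun u => sosModel f p δ σ x (u • s) with hφ
  have hcvx : ConvexOn ℝ Set.univ φ := hconv.convexOn_ray s
  have hmin : ∀ u, φ 1 ≤ φ u := fun u => by
    have : sosModel f p δ σ x s ≤ sosModel f p δ σ x (u • s) := hs (Set.mem_univ (u • s))
    simpa [hφ] using this
  -- A convex function minimized at `1` is nonincreasing on `[0, 1]`.
  have hmono : φ θ ≤ φ (θ / 2) :=
    (hcvx.le_max_of_mem_Icc (Set.mem_univ (θ / 2)) (Set.mem_univ 1)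
      ⟨by linarith, hθ1⟩).trans_eq (max_eq_left (hmin _))
  set μ := perturbation δ (lamMin f x) with hμ
  set B := iteratedFDeriv ℝ 2 f x (fun _ => s) with hB
  set D := iteratedFDeriv ℝ 1 f x (fun _ => s) with hD
  have hquad : δ * ‖s‖ ^ 2 ≤ B + μ * ‖s‖ ^ 2 := le_iteratedFDeriv_two_add_perturbation hf2 x s δ
  have hexp : ∀ u : ℝ, 0 ≤ u → u * ‖s‖ ≤ 1 →
      |φ u - (f x + u * D + u ^ 2 / 2 * (B + μ * ‖s‖ ^ 2) +
        σ / (regOrder p : ℝ) * (u ^ regOrder p * ‖s‖ ^ regOrder p))| ≤ K * (u * ‖s‖) ^ 3 := by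
    intro u hu hus
    have hn : ‖u • s‖ = u * ‖s‖ := by rw [norm_smul, Real.norm_of_nonneg hu]
    have h3 := norm_taylorPoly_sub_le f (m := p) (k := 3) (by omega) x (hn.trans_le hus)
    have h4 := mul_le_mul_of_nonneg_right (sum_Ico_norm_le hK (k := 3) (by norm_num))
      (pow_nonneg (norm_nonneg (u • s)) 3)
    have h5 := h3.trans h4
    rw [hn, Finset.sum_range_succ, Finset.sum_range_succ, Finset.sum_range_one,
      Real.norm_eq_abs] at h5
    simp only [iteratedFDeriv_smul_diag] at h5
    refine le_trans (le_of_eq ?_) h5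
    congr 1
    simp only [hφ, sosModel, taylorModel_eq_taylorPoly, hn, Nat.factorial_zero, Nat.factorial_one,
      Nat.factorial_two, Nat.cast_one, Nat.cast_two, iteratedFDeriv_zero_apply, mul_pow,
      smul_eq_mul, ← hB, ← hD, ← hμ]
    ring
  have h1 := (abs_le.1 (hexp θ hθ0 (hθ.trans_le hr1))).1
  have h2 := (abs_le.1 (hexp (θ / 2) (by linarith) (by linarith))).2
  have hhalf : θ / 2 * ‖s‖ = r / 2 := by linarith
  rw [hθ] at h1
  rw [hhalf] at h2
  have hreg : (θ / 2) ^ regOrder p * ‖s‖ ^ regOrder p ≤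
      1 / 2 * (θ ^ regOrder p * ‖s‖ ^ regOrder p) := by
    rw [div_pow, div_eq_mul_inv, mul_right_comm, mul_comm]
    refine mul_le_mul_of_nonneg_right ?_ (by positivity)
    rw [regOrder_eq, ← inv_pow]
    calc (2 : ℝ)⁻¹ ^ (2 * (p / 2 + 1)) ≤ 2⁻¹ ^ 1 :=
          pow_le_pow_of_le_one (by norm_num) (by norm_num) (by omega)
      _ = 1 / 2 := by norm_num
  have hreg' := mul_le_mul_of_nonneg_left hreg (by positivity : 0 ≤ σ / (regOrder p : ℝ))
  have hθB : δ * r ^ 2 ≤ θ ^ 2 * (B + μ * ‖s‖ ^ 2) := by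
    calc δ * r ^ 2 = θ ^ 2 * (δ * ‖s‖ ^ 2) := by rw [← hθ]; ring
      _ ≤ _ := by gcongr
  have hr3 : K * r ^ 3 ≤ δ / 32 * r ^ 2 := by
    calc K * r ^ 3 = r * K * r ^ 2 := by ring
      _ ≤ _ := by gcongr
  have hφ0 : φ 0 = f x := by simp [hφ, sosModel_zero]
  have hfin := sub_sosModel_le hδ.le hσ hs ((θ / 2) • s)
  change f x - φ (θ / 2) ≤ _ at hfin
  refine le_trans ?_ hfin
  have e1 : (r / 2) ^ 3 = r ^ 3 / 8 := by ring
  have e2 : (θ / 2) ^ 2 / 2 * (B + μ * ‖s‖ ^ 2) = θ ^ 2 * (B + μ * ‖s‖ ^ 2) / 8 := by ring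
  have e3 : θ ^ 2 / 2 * (B + μ * ‖s‖ ^ 2) = θ ^ 2 * (B + μ * ‖s‖ ^ 2) / 2 := by ring
  rw [e3] at h1
  rw [e1, e2] at h2
  -- The combination `2 φ(θ/2) - φ(θ)` cancels the linear term. With `hmono` and `hreg'` this leaves
  -- a decrease of at least `δ r² / 4` minus remainders of at most `(5/4) (δ/32) r²`.
  nlinarith [mul_nonneg hδ.le (sq_nonneg r)]

end Step

end ARpSoS

end

noncomputable section

namespace ARpSoS

/-! ### Exponents -/

/-- The exponent `w` for which the regularization parameters are `O(ε ^ (-w))`. -/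
def sigmaExponent (p : ℕ) (a : ℝ) : ℝ :=
  if Odd p then a * ((p : ℝ) - 2) else max 1 (a * ((p : ℝ) - 1))

theorem regOrder_of_odd {p : ℕ} (h : Odd p) : regOrder p = p + 1 := if_pos h

theorem regOrder_of_even {p : ℕ} (h : Even p) : regOrder p = p + 2 :=
  if_neg (Nat.not_odd_iff_even.2 h)

theorem sigmaExponent_of_odd {p : ℕ} (h : Odd p) (a : ℝ) :
    sigmaExponent p a = a * ((p : ℝ) - 2) := if_pos h

theorem sigmaExponent_of_even {p : ℕ} (h : Even p) (a : ℝ) :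
    sigmaExponent p a = max 1 (a * ((p : ℝ) - 1)) := if_neg (Nat.not_odd_iff_even.2 h)

section Exponents

variable {p : ℕ} {a : ℝ}

theorem succ_le_regOrder (p : ℕ) : p + 1 ≤ regOrder p := by
  unfold regOrder
  split_ifs <;> omega

theorem sigmaExponent_nonneg (hp : 3 ≤ p) (ha : 0 ≤ a) : 0 ≤ sigmaExponent p a := by
  have hp' : (3 : ℝ) ≤ p := by exact_mod_cast hp
  unfold sigmaExponent
  split_ifs
  · exact mul_nonneg ha (by linarith)
  · exact zero_le_one.trans (le_max_left _ _)

theorem mul_le_sigmaExponent (p : ℕ) (a : ℝ) :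
    a * ((regOrder p : ℝ) - 3) ≤ sigmaExponent p a := by
  rcases Nat.even_or_odd p with h | h
  · rw [regOrder_of_even h, sigmaExponent_of_even h]
    refine le_trans (le_of_eq ?_) (le_max_right _ _)
    push_cast
    ring
  · rw [regOrder_of_odd h, sigmaExponent_of_odd h]
    push_cast
    linarith

/-- This is `decreaseExponent p a ≤ 2 - a` with denominators cleared. It is what requires `a ≤ 1 /
2`: for odd `p` it is an equality at `a = 1 / 2`. -/
theorem sigmaExponent_le (hp : 3 ≤ p) (ha1 : a ≤ 1 / 2) :
    sigmaExponent p a ≤ (regOrder p : ℝ) - 2 - a * ((regOrder p : ℝ) - 1) := by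
  have hp' : (3 : ℝ) ≤ p := by exact_mod_cast hp
  rcases Nat.even_or_odd p with h | h
  · rw [regOrder_of_even h, sigmaExponent_of_even h]
    push_cast
    refine max_le ?_ ?_ <;> nlinarith
  · rw [regOrder_of_odd h, sigmaExponent_of_odd h]
    push_cast
    nlinarith

/-- The exponent of `ε` in the locally strongly convex case. -/
def decreaseExponent (p : ℕ) (a : ℝ) : ℝ :=
  ((regOrder p : ℝ) + sigmaExponent p a) / ((regOrder p : ℝ) - 1)

theorem four_le_regOrder (hp : 3 ≤ p) : (4 : ℝ) ≤ regOrder p := by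
  exact_mod_cast (by omega : 4 ≤ p + 1).trans (succ_le_regOrder p)

/-- The left side is the exponent that `convex_decrease` yields when the step is at least of order
`ε ^ (1 / p)`, so the Taylor alternative is never worse than the regularization alternative. -/
theorem add_two_mul_max_le_decreaseExponent (hp : 3 ≤ p) (ha : 0 ≤ a) (ha1 : a ≤ 1 / 2) :
    a + 2 * max (1 / (p : ℝ)) a ≤ decreaseExponent p a := by
  have hN := four_le_regOrder hp
  have hw0 := sigmaExponent_nonneg hp ha
  have hw := mul_le_sigmaExponent p a
  have hp' : (3 : ℝ) ≤ p := by exact_mod_cast hp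
  rw [decreaseExponent, le_div_iff₀ (by linarith)]
  rcases le_total (1 / (p : ℝ)) a with h | h
  · rw [max_eq_right h]
    nlinarith
  · rw [max_eq_left h]
    have h3 : 1 / (p : ℝ) ≤ 1 / 3 := one_div_le_one_div_of_le (by norm_num) hp'
    nlinarith

theorem decreaseExponent_le (hp : 3 ≤ p) (ha1 : a ≤ 1 / 2) : decreaseExponent p a ≤ 2 - a := by
  have hN := four_le_regOrder hp
  have hw := sigmaExponent_le hp ha1
  rw [decreaseExponent, div_le_iff₀ (by linarith)]
  linarith

end Exponents

/-! ### Lower bounds on the decrease -/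

section Decrease

variable {p : ℕ} {a ε t σ M K S D : ℝ}

/-- The minimum with `1` avoids a `k`th root in the constant: a number in `[0, 1]` dominates its
`k`th power. -/
theorem le_of_rpow_le_mul_pow {k : ℕ} (hk : k ≠ 0) {C b : ℝ} (hC : 0 < C) (hε : 0 < ε)
    (ht : 0 ≤ t) (h : ε ^ b ≤ C * t ^ k) : min 1 C⁻¹ * ε ^ (b / k) ≤ t := by
  have hc0 : 0 ≤ min 1 C⁻¹ := by positivity
  refine le_of_pow_le_pow_left₀ hk ht ?_
  rw [mul_pow, ← Real.rpow_natCast (ε ^ (b / k)), ← Real.rpow_mul hε.le,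
    div_mul_cancel₀ _ (Nat.cast_ne_zero.2 hk)]
  calc min 1 C⁻¹ ^ k * ε ^ b ≤ C⁻¹ * ε ^ b := by
        gcongr
        calc min 1 C⁻¹ ^ k ≤ min 1 C⁻¹ ^ 1 :=
              pow_le_pow_of_le_one hc0 (min_le_left _ _) (Nat.one_le_iff_ne_zero.2 hk)
          _ ≤ C⁻¹ := by rw [pow_one]; exact min_le_right _ _
    _ ≤ C⁻¹ * (C * t ^ k) := by gcongr
    _ = t ^ k := by field_simp

/-- The decrease when the regularization dominates the gradient. -/
theorem decrease_of_le_reg (hp : 3 ≤ p) (hS : 0 < S) (hε : 0 < ε) (ht : 0 ≤ t)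
    (hσ : σ ≤ S * ε ^ (-sigmaExponent p a)) (hreg : ε / 3 ≤ σ * t ^ (regOrder p - 1))
    (hD : σ / (regOrder p : ℝ) * t ^ regOrder p ≤ D) :
    min 1 (3 * S)⁻¹ / (3 * regOrder p) * ε ^ decreaseExponent p a ≤ D := by
  have hN := four_le_regOrder hp
  have hN1 : 1 ≤ regOrder p := by
    have := succ_le_regOrder p
    omega
  set w := sigmaExponent p a with hw
  have hk : ((regOrder p - 1 : ℕ) : ℝ) = (regOrder p : ℝ) - 1 := by
    rw [Nat.cast_sub hN1, Nat.cast_one]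
  have h1 : ε ^ (1 + w) ≤ 3 * S * t ^ (regOrder p - 1) := by
    have h2 : ε ≤ 3 * (S * ε ^ (-w) * t ^ (regOrder p - 1)) := by
      have : σ * t ^ (regOrder p - 1) ≤ S * ε ^ (-w) * t ^ (regOrder p - 1) := by gcongr
      linarith
    calc ε ^ (1 + w) = ε * ε ^ w := by rw [Real.rpow_add hε, Real.rpow_one]
      _ ≤ 3 * (S * ε ^ (-w) * t ^ (regOrder p - 1)) * ε ^ w := by gcongr
      _ = 3 * S * t ^ (regOrder p - 1) * (ε ^ (-w) * ε ^ w) := by ring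
      _ = _ := by rw [← Real.rpow_add hε, neg_add_cancel, Real.rpow_zero, mul_one]
  have h2 := le_of_rpow_le_mul_pow (by
    have := succ_le_regOrder p
    omega) (by positivity) hε ht h1
  rw [hk] at h2
  have hE : decreaseExponent p a = 1 + (1 + w) / ((regOrder p : ℝ) - 1) := by
    have : (regOrder p : ℝ) - 1 ≠ 0 := by linarith
    rw [decreaseExponent, ← hw]
    field_simp
    ring
  have hpow : t ^ regOrder p = t ^ (regOrder p - 1) * t := by
    rw [← pow_succ, Nat.sub_add_cancel hN1]
  have hreg0 : 0 ≤ σ * t ^ (regOrder p - 1) := le_trans (by positivity) hreg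
  refine le_trans ?_ hD
  rw [hE, Real.rpow_add hε, Real.rpow_one, hpow]
  calc min 1 (3 * S)⁻¹ / (3 * regOrder p) * (ε * ε ^ ((1 + w) / ((regOrder p : ℝ) - 1)))
      = ε / 3 * (min 1 (3 * S)⁻¹ * ε ^ ((1 + w) / ((regOrder p : ℝ) - 1))) / regOrder p := by
        field_simp
    _ ≤ σ * t ^ (regOrder p - 1) * t / regOrder p := by gcongr
    _ = _ := by ring

/-- The decrease when the Taylor error dominates the gradient. -/
theorem decrease_of_le_taylor (hp : 3 ≤ p) (ha : 0 ≤ a) (ha1 : a ≤ 1 / 2) (hM : 0 < M)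
    (hK : 0 < K) (hε : 0 < ε) (hε1 : ε < 1) (ht : 0 ≤ t) (htaylor : ε / 3 ≤ M * t ^ p)
    (hD : ε ^ a / 8 * (min t (ε ^ a / (32 * K))) ^ 2 ≤ D) :
    (min (min 1 (3 * M)⁻¹) (32 * K)⁻¹) ^ 2 / 8 * ε ^ decreaseExponent p a ≤ D := by
  have h1 : min 1 (3 * M)⁻¹ * ε ^ (1 / (p : ℝ)) ≤ t :=
    le_of_rpow_le_mul_pow (by omega) (by positivity) hε ht (by rw [Real.rpow_one]; linarith)
  set c := min (min 1 (3 * M)⁻¹) (32 * K)⁻¹ with hc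
  have hc0 : 0 ≤ c := by positivity
  set b := max (1 / (p : ℝ)) a with hb
  have h2 : c * ε ^ b ≤ min t (ε ^ a / (32 * K)) := by
    refine le_min (le_trans ?_ h1) ?_
    · exact mul_le_mul (min_le_left _ _)
        (Real.rpow_le_rpow_of_exponent_ge hε hε1.le (le_max_left _ _)) (by positivity)
        (by positivity)
    · rw [div_eq_inv_mul]
      exact mul_le_mul (min_le_right _ _)
        (Real.rpow_le_rpow_of_exponent_ge hε hε1.le (le_max_right _ _)) (by positivity)
        (by positivity)
  have h3 : ε ^ decreaseExponent p a ≤ ε ^ a * (ε ^ b) ^ 2 := by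
    rw [← Real.rpow_natCast (ε ^ b), ← Real.rpow_mul hε.le, ← Real.rpow_add hε]
    refine Real.rpow_le_rpow_of_exponent_ge hε hε1.le ?_
    have := add_two_mul_max_le_decreaseExponent hp ha ha1
    push_cast
    linarith
  refine le_trans ?_ hD
  calc c ^ 2 / 8 * ε ^ decreaseExponent p a ≤ c ^ 2 / 8 * (ε ^ a * (ε ^ b) ^ 2) := by gcongr
    _ = ε ^ a / 8 * (c * ε ^ b) ^ 2 := by ring
    _ ≤ _ := by gcongr

/-- The decrease when the perturbation dominates the gradient. -/
theorem decrease_of_le_perturbation (hε : 0 < ε) (hpert : ε / 3 ≤ ε ^ a * t)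
    (hD : ε ^ a / 2 * t ^ 2 ≤ D) : 1 / 18 * ε ^ (2 - a) ≤ D := by
  have hδ : 0 < ε ^ a := by positivity
  refine le_trans ?_ hD
  rw [Real.rpow_sub hε, Real.rpow_two]
  calc 1 / 18 * (ε ^ 2 / ε ^ a) = (ε / 3) ^ 2 / (2 * ε ^ a) := by field_simp; norm_num
    _ ≤ (ε ^ a * t) ^ 2 / (2 * ε ^ a) := by gcongr
    _ = _ := by field_simp

/-- The decrease at the Cauchy point `α ε` along the negative gradient. -/
theorem decrease_of_cauchy (hp : 3 ≤ p) (ha : 0 ≤ a) (ha1 : a ≤ 1 / 2) (hK : 1 ≤ K) (hS : 0 < S)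
    (hε : 0 < ε) (hε1 : ε < 1) {G μ : ℝ} (hG : ε ≤ G) (hμ : μ ≤ K + 1)
    (hσ : σ ≤ S * ε ^ (-sigmaExponent p a))
    (hD : ∀ r : ℝ, 0 ≤ r → r ≤ 1 →
      r * G - (K + μ / 2) * r ^ 2 - σ / (regOrder p : ℝ) * r ^ regOrder p ≤ D) :
    1 / (4 * (2 * K + 1 + S)) * ε ^ 2 ≤ D := by
  have hN := four_le_regOrder hp
  have hNpos : 0 < (regOrder p : ℝ) := by linarith
  have hw := sigmaExponent_le hp ha1
  set w := sigmaExponent p a with hwdef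
  -- This is the maximizer of `α - (2K + 1 + S) α²`. Here `2K + 1` bounds `K + μ/2`, and `S`
  -- accounts for the regularization, which is of order `ε²` because `w ≤ p' - 2`.
  set α := 1 / (2 * (2 * K + 1 + S)) with hα
  have hα0 : 0 < α := by positivity
  have hα1 : α ≤ 1 := by
    rw [hα, div_le_one (by positivity)]
    linarith
  have h := hD (α * ε) (by positivity) (mul_le_one₀ hα1 hε.le hε1.le)
  refine le_trans ?_ h
  have h1 : σ / (regOrder p : ℝ) * (α * ε) ^ regOrder p ≤ S * α ^ 2 * ε ^ 2 := by
    have e1 : α ^ regOrder p ≤ α ^ 2 :=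
      pow_le_pow_of_le_one hα0.le hα1 (by exact_mod_cast (by linarith : (2 : ℝ) ≤ regOrder p))
    have e2 : ε ^ (-w) * ε ^ regOrder p ≤ ε ^ 2 := by
      rw [← Real.rpow_natCast ε (regOrder p), ← Real.rpow_add hε, ← Real.rpow_two]
      refine Real.rpow_le_rpow_of_exponent_ge hε hε1.le ?_
      nlinarith
    calc σ / (regOrder p : ℝ) * (α * ε) ^ regOrder p
        ≤ (S * ε ^ (-w)) / (regOrder p : ℝ) * (α * ε) ^ regOrder p := by gcongr
      _ ≤ (S * ε ^ (-w)) / 1 * (α * ε) ^ regOrder p := by gcongr; linarith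
      _ = S * α ^ regOrder p * (ε ^ (-w) * ε ^ regOrder p) := by rw [mul_pow]; ring
      _ ≤ S * α ^ 2 * ε ^ 2 := by gcongr
  have h2 : α * ε ^ 2 ≤ α * ε * G := by
    rw [sq, ← mul_assoc]
    gcongr
  have h3 : (K + μ / 2) * (α * ε) ^ 2 ≤ (2 * K + 1) * (α * ε) ^ 2 :=
    mul_le_mul_of_nonneg_right (by linarith) (sq_nonneg _)
  have h4 : (2 * K + 1 + S) * α = 1 / 2 := by
    rw [hα]
    field_simp
  have h5 : 1 / (4 * (2 * K + 1 + S)) = α / 2 := by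
    rw [hα]
    field_simp
    norm_num
  have h6 : (2 * K + 1) * (α * ε) ^ 2 + S * α ^ 2 * ε ^ 2 = α / 2 * ε ^ 2 := by
    calc _ = ((2 * K + 1 + S) * α) * (α * ε ^ 2) := by ring
      _ = _ := by rw [h4]; ring
  rw [h5]
  linarith

end Decrease

end ARpSoS

end

noncomputable section

namespace ARpSoS

/-! ### The regularization parameters along a run -/

section Run

variable {n p : ℕ} {f : EuclideanSpace ℝ (Fin n) → ℝ} {L δ σ η ε K : ℝ}
  {x s : EuclideanSpace ℝ (Fin n)}

theorem norm_gradient (f : EuclideanSpace ℝ (Fin n) → ℝ) (x : EuclideanSpace ℝ (Fin n)) :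
    ‖gradient f x‖ = ‖fderiv ℝ f x‖ := by
  rw [← toDual_gradient, LinearIsometryEquiv.norm_map]

theorem regularization_le_sub_taylorModel (hδ : 0 ≤ δ)
    (hs : IsMinOn (sosModel f p δ σ x) Set.univ s) :
    σ / (regOrder p : ℝ) * ‖s‖ ^ regOrder p ≤ f x - taylorModel f p x s := by
  have h := le_sub_taylorModel hs
  have hμ : 0 ≤ perturbation δ (lamMin f x) := perturbation_nonneg hδ
  have : 0 ≤ perturbation δ (lamMin f x) / 2 * ‖s‖ ^ 2 := by positivity
  linarith

theorem sub_taylorModel_nonneg (hδ : 0 ≤ δ) (hσ : 0 ≤ σ)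
    (hs : IsMinOn (sosModel f p δ σ x) Set.univ s) : 0 ≤ f x - taylorModel f p x s :=
  le_trans (by positivity) (regularization_le_sub_taylorModel hδ hs)

theorem Successful.lt_sub (h : Successful f p η x s) (hη : 0 < η)
    (hD : 0 ≤ f x - taylorModel f p x s) :
    η * (f x - taylorModel f p x s) < f x - f (x + s) := by
  have h' : η < (f x - f (x + s)) / (f x - taylorModel f p x s) := h
  rcases hD.eq_or_lt with h0 | h0
  -- With zero predicted decrease the ratio is `0` by convention, so the iteration is not
  -- successful.
  · rw [← h0, div_zero] at h'
    exact absurd h' hη.not_gt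
  · exact (lt_div_iff₀ h0).1 h'

theorem perturbation_lamMin_le (hp : 2 ≤ p) (hf : ContDiff ℝ p f) (hδ1 : δ ≤ 1)
    (hK : ∑ j ∈ Finset.Icc 1 p, ‖iteratedFDeriv ℝ j f x‖ ≤ K) :
    perturbation δ (lamMin f x) ≤ K + 1 := by
  have h2 : ‖iteratedFDeriv ℝ 2 f x‖ ≤ K :=
    (Finset.single_le_sum (f := fun j => ‖iteratedFDeriv ℝ j f x‖) (fun _ _ => norm_nonneg _)
      (Finset.mem_Icc.2 ⟨by norm_num, hp⟩)).trans hK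
  have h3 := neg_norm_le_lamMin (hf.of_le (by exact_mod_cast hp)) x
  exact perturbation_le hδ1 ((norm_nonneg _).trans h2) (by linarith)

/-- The regularization parameter of an unsuccessful iteration is bounded. -/
theorem le_of_not_successful (hp : 3 ≤ p) (hf : IsCp1 p L f) (hL : 0 < L) (hη1 : η < 1)
    (hδ : 0 ≤ δ) (hδ1 : δ ≤ 1) (hσ : 0 < σ) (hK1 : 0 ≤ K)
    (hK : ∑ j ∈ Finset.Icc 1 p, ‖iteratedFDeriv ℝ j f x‖ ≤ K) (hε : 0 < ε) (hε1 : ε < 1)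
    {a Q : ℝ} (ha : 0 ≤ a) (hQ : Q = (p - 1).factorial * L * regOrder p / (1 - η))
    (hg : ε < ‖gradient f x‖) (hs : IsMinOn (sosModel f p δ σ x) Set.univ s)
    (hns : ¬ Successful f p η x s) :
    σ ≤ Q * (2 * K + 1 + Q) * ε ^ (-sigmaExponent p a) := by
  have hN := four_le_regOrder hp
  have hQ0 : 0 ≤ Q := by
    rw [hQ]
    have : 0 < 1 - η := by linarith
    positivity
  set M := (p - 1).factorial * L with hM
  set t := ‖s‖ with ht
  have ht0 : 0 ≤ t := norm_nonneg s
  have hμ := perturbation_lamMin_le (by omega) hf.contDiff hδ1 hK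
  set μ := perturbation δ (lamMin f x) with hμdef
  rw [norm_gradient] at hg
  have hgrad : t ≤ 1 → ‖fderiv ℝ f x‖ ≤ K * t + μ * t + σ * t ^ (regOrder p - 1) := fun h =>
    norm_fderiv_le (by omega) hf.contDiff hδ hσ.le hs h hK
  have hN0 : regOrder p - 1 ≠ 0 := by
    have := succ_le_regOrder p
    omega
  have htpos : 0 < t := by
    refine ht0.lt_of_ne' fun h0 => ?_
    have h := hgrad (by rw [h0]; exact zero_le_one)
    rw [h0, zero_pow hN0] at h
    linarith
  have hDlow := regularization_le_sub_taylorModel hδ hs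
  have hDpos : 0 < f x - taylorModel f p x s := lt_of_lt_of_le (by positivity) hDlow
  have hle : f x - f (x + s) ≤ η * (f x - taylorModel f p x s) :=
    (div_le_iff₀ hDpos).1 (not_lt.1 hns)
  have herr := (abs_le.1 (hf.abs_sub_taylorModel_le hL.le x s)).2
  -- Failure of the ratio test means that the Taylor error exceeds the fraction `1 - η` of the
  -- predicted decrease, which is at least the regularization term.
  have hkey : σ * t ^ regOrder p ≤ Q * t ^ (p + 1) := by
    have h1 : (1 - η) * (σ / (regOrder p : ℝ) * t ^ regOrder p) ≤ M * t ^ (p + 1) := by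
      have := mul_le_mul_of_nonneg_left hDlow (by linarith : 0 ≤ 1 - η)
      linarith
    have hη' : 0 < 1 - η := by linarith
    rw [hQ, div_mul_eq_mul_div, le_div_iff₀ hη']
    calc σ * t ^ regOrder p * (1 - η)
        = (1 - η) * (σ / (regOrder p : ℝ) * t ^ regOrder p) * regOrder p := by field_simp
      _ ≤ M * t ^ (p + 1) * regOrder p := by gcongr
      _ = _ := by ring
  have hwpos : 1 ≤ ε ^ (-sigmaExponent p a) :=
    Real.one_le_rpow_of_pos_of_le_one_of_nonpos hε hε1.le
      (neg_nonpos.2 (sigmaExponent_nonneg hp ha))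
  rcases Nat.even_or_odd p with hpar | hpar
  · rw [regOrder_of_even hpar] at hkey hgrad
    -- For even `p` the regularization is one order higher than the error, so only `σ t` is bounded.
    -- Dividing by `t`, which is at least a multiple of `ε`, is the origin of the `1` in
    -- `sigmaExponent`.
    have hσt : σ * t ≤ Q := by
      have h : (σ * t) * t ^ (p + 1) ≤ Q * t ^ (p + 1) := by
        calc _ = σ * t ^ (p + 2) := by ring
          _ ≤ _ := hkey
      exact le_of_mul_le_mul_right h (by positivity)
    have hεw : ε⁻¹ ≤ ε ^ (-sigmaExponent p a) := by
      rw [← Real.rpow_neg_one]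
      refine Real.rpow_le_rpow_of_exponent_ge hε hε1.le (neg_le_neg ?_)
      rw [sigmaExponent_of_even hpar]
      exact le_max_left _ _
    have hεt : ε ≤ (2 * K + 1 + Q) * t := by
      rcases le_total t 1 with h1 | h1
      · have h2 := hgrad h1
        have h3 : σ * t ^ (p + 2 - 1) ≤ Q * t := by
          have h4 : t ^ p ≤ t := by
            calc t ^ p ≤ t ^ 1 := pow_le_pow_of_le_one ht0 h1 (by omega)
              _ = t := pow_one t
          calc σ * t ^ (p + 2 - 1) = σ * t * t ^ p := by
                rw [show p + 2 - 1 = p + 1 by omega, pow_succ]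
                ring
            _ ≤ Q * t := by gcongr
        have h5 : μ * t ≤ (K + 1) * t := by gcongr
        linarith
      · nlinarith
    calc σ = σ * ε * ε⁻¹ := by field_simp
      _ ≤ σ * ((2 * K + 1 + Q) * t) * ε⁻¹ := by gcongr
      _ = σ * t * (2 * K + 1 + Q) * ε⁻¹ := by ring
      _ ≤ Q * (2 * K + 1 + Q) * ε ^ (-sigmaExponent p a) := by gcongr
  · rw [regOrder_of_odd hpar] at hkey
    have hσQ : σ ≤ Q := le_of_mul_le_mul_right hkey (by positivity)
    rcases le_total 1 Q with h1 | h1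
    · calc σ ≤ Q * 1 * 1 := by linarith
        _ ≤ Q * (2 * K + 1 + Q) * ε ^ (-sigmaExponent p a) := by
          gcongr
          linarith
    · calc σ ≤ Q * 1 * 1 := by linarith
        _ ≤ Q * (2 * K + 1 + Q) * ε ^ (-sigmaExponent p a) := by
          gcongr
          linarith

/-- The least SoS-convexifying parameter is bounded. -/
theorem sosBound_le (hp : 3 ≤ p) (hf : ContDiff ℝ p f) {a K₂ t : ℝ} (hε : 0 < ε) (hε1 : ε < 1)
    (ha : 0 ≤ a) (hK₂ : 1 ≤ K₂)
    (hK : ∑ j ∈ Finset.Ico 3 (p + 1),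
      (n : ℝ) ^ j * ((n : ℝ) ^ 2 * (p : ℝ) ^ 2 * ‖iteratedFDeriv ℝ j f x‖) ≤ K₂)
    (ht : IsLeast {t : ℝ | IsSOSConvex (sosModel f p (ε ^ a) t x)} t) :
    t ≤ K₂ ^ (2 * (p / 2)) * ε ^ (-sigmaExponent p a) := by
  have hδ : 0 < ε ^ a := by positivity
  have hδ1 : ε ^ a ≤ 1 := Real.rpow_le_one hε.le hε1.le ha
  refine (ht.2 (isSOSConvex_sosModel (by omega) hf hδ x (hδ1.trans hK₂) hK)).trans ?_
  have hw := mul_le_sigmaExponent p a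
  rw [regOrder_eq] at hw
  push_cast at hw
  -- The resulting exponent of `ε` is `-a (p' - 3)`, which `mul_le_sigmaExponent` compares with
  -- `-w`.
  have h1 : ε ^ a * (K₂ / ε ^ a) ^ (2 * (p / 2)) =
      K₂ ^ (2 * (p / 2)) * ε ^ (a - a * ((2 * (p / 2) : ℕ) : ℝ)) := by
    rw [div_pow, Real.rpow_sub hε, Real.rpow_mul hε.le, Real.rpow_natCast]
    field_simp
  rw [h1]
  refine mul_le_mul_of_nonneg_left (Real.rpow_le_rpow_of_exponent_ge hε hε1.le ?_) (by positivity)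
  push_cast
  linarith

end Run

/-! ### Induction along the run -/

section Bounds

variable {n p : ℕ} {f : EuclideanSpace ℝ (Fin n) → ℝ} {L ε a σmin η γ₁ γ₂ K K₂ Q : ℝ}
  {x s : ℕ → EuclideanSpace ℝ (Fin n)} {σr σbar σ : ℕ → ℝ}

theorem Performed.of_succ {k : ℕ} (h : Performed f ε x (k + 1)) : Performed f ε x k :=
  fun j hj => h j (hj.trans (Nat.le_succ k))

/-- Along a run the regularization parameters lie between `σmin` and a multiple of
`ε ^ (-w)`. -/
theorem IsRun.sigma_bounds (hrun : IsRun f p ε (ε ^ a) σmin η γ₁ γ₂ x s σr σbar σ) (hp : 3 ≤ p)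
    (hf : IsCp1 p L f) (hL : 0 < L) (hσmin : 0 < σmin) (hη1 : η < 1) (hγ₁ : 1 < γ₁)
    (hγ₂ : γ₂ < 1) (hε : 0 < ε) (hε1 : ε < 1) (ha : 0 ≤ a) (hK0 : 0 ≤ K) (hK₂ : 1 ≤ K₂)
    (hQ : Q = (p - 1).factorial * L * regOrder p / (1 - η))
    (hK : ∀ k, Performed f ε x k → ∑ j ∈ Finset.Icc 1 p, ‖iteratedFDeriv ℝ j f (x k)‖ ≤ K)
    (hK' : ∀ k, Performed f ε x k → ∑ j ∈ Finset.Ico 3 (p + 1),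
      (n : ℝ) ^ j * ((n : ℝ) ^ 2 * (p : ℝ) ^ 2 * ‖iteratedFDeriv ℝ j f (x k)‖) ≤ K₂)
    (k : ℕ) (hk : Performed f ε x k) :
    σmin ≤ σ k ∧ σ k ≤ (σmin + K₂ ^ (2 * (p / 2)) + γ₁ * (Q * (2 * K + 1 + Q))) *
      ε ^ (-sigmaExponent p a) := by
  have hδ : 0 < ε ^ a := by positivity
  have hδ1 : ε ^ a ≤ 1 := Real.rpow_le_one hε.le hε1.le ha
  have hQ0 : 0 ≤ Q := by
    rw [hQ]
    have : 0 < 1 - η := by linarith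
    positivity
  set A := ε ^ (-sigmaExponent p a) with hA
  have hA1 : 1 ≤ A := Real.one_le_rpow_of_pos_of_le_one_of_nonpos hε hε1.le
    (neg_nonpos.2 (sigmaExponent_nonneg hp ha))
  set S₁ := K₂ ^ (2 * (p / 2)) with hS₁
  set S₂ := Q * (2 * K + 1 + Q) with hS₂
  have hS₁0 : 0 ≤ S₁ := by positivity
  have hS₂0 : 0 ≤ S₂ := by positivity
  have hσmA : σmin ≤ (σmin + S₁ + γ₁ * S₂) * A := by
    have h0 : 0 ≤ γ₁ * S₂ := by positivity
    nlinarith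
  -- The induction runs on `σr`, the quantity passed from one iteration to the next; the bounds for
  -- `σ` follow at each index.
  have hused : ∀ k, Performed f ε x k →
      (σmin ≤ σr k ∧ σr k ≤ (σmin + S₁ + γ₁ * S₂) * A) →
      σmin ≤ σ k ∧ σ k ≤ (σmin + S₁ + γ₁ * S₂) * A := by
    intro k hk h
    rw [hrun.σ_eq k hk]
    refine ⟨h.1.trans (le_max_right _ _), max_le ?_ h.2⟩
    refine (sosBound_le hp hf.contDiff hε hε1 ha hK₂ (hK' k hk) (hrun.sos_program k hk)).trans ?_
    have h0 : 0 ≤ γ₁ * S₂ := by positivity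
    gcongr
    linarith
  refine hused k hk ?_
  induction k with
  | zero => rw [hrun.σr_zero]; exact ⟨le_rfl, hσmA⟩
  | succ k ih =>
    have hk' := hk.of_succ
    have hσk := hused k hk' (ih hk')
    have hσk0 : 0 < σ k := hσmin.trans_le hσk.1
    by_cases hsucc : Successful f p η (x k) (s k)
    · rw [(hrun.success k hk' hsucc).2]
      refine ⟨le_max_right _ _, max_le (le_trans ?_ hσk.2) hσmA⟩
      nlinarith
    · rw [(hrun.failure k hk' hsucc).2]
      have h1 := le_of_not_successful hp hf hL hη1 hδ.le hδ1 hσk0 hK0 (hK k hk') hε hε1 ha hQ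
        (hk' k le_rfl) (hrun.step k hk') hsucc
      refine ⟨by nlinarith, ?_⟩
      calc γ₁ * σ k ≤ γ₁ * (S₂ * A) := by gcongr
        _ = γ₁ * S₂ * A := by ring
        _ ≤ _ := by
          gcongr
          linarith

end Bounds

end ARpSoS

end

/-! ### Assembly of the four cases -/

theorem mainTheorem3 (n p : ℕ) (hp : 3 ≤ p) (L : ℝ) (hL : 0 < L) (Λ : ℕ → ℝ)
    (σmin η γ₁ : ℝ) (hσmin : 0 < σmin) (hη : 0 < η) (hη1 : η < 1) (hγ₁ : 1 < γ₁) :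
    ∃ κ₁ κ₂ κ₃ κ₄ : ℝ, 0 < κ₁ ∧ 0 < κ₂ ∧ 0 < κ₃ ∧ 0 < κ₄ ∧
      ∀ f : EuclideanSpace ℝ (Fin n) → ℝ, ARpSoS.IsCp1 p L f →
      ∀ ε a γ₂ : ℝ, 0 < ε → ε < 1 → 0 ≤ a → a ≤ 1 / 2 → 0 < γ₂ → γ₂ < 1 →
      ∀ (x s : ℕ → EuclideanSpace ℝ (Fin n)) (σr σbar σ : ℕ → ℝ),
        ARpSoS.IsRun f p ε (ε ^ a) σmin η γ₁ γ₂ x s σr σbar σ →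
        (∀ k, ARpSoS.Performed f ε x k →
          ∀ j ∈ Finset.Icc 1 p, ‖iteratedFDeriv ℝ j f (x k)‖ ≤ Λ j) →
        ∀ k, ARpSoS.Performed f ε x k → ARpSoS.Successful f p η (x k) (s k) →
          -- Case 1, odd order
          (ε < ‖gradient f (x (k + 1))‖ → Odd p → ε ^ a ≤ ARpSoS.lamMin f (x k) →
            f (x k) - f (x k + s k) >
              κ₁ * η * ε ^ (((p : ℝ) + 1 + a * ((p : ℝ) - 2)) / (p : ℝ))) ∧
          -- Case 1, even order
          (ε < ‖gradient f (x (k + 1))‖ → Even p → ε ^ a ≤ ARpSoS.lamMin f (x k) →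
            f (x k) - f (x k + s k) >
              κ₂ * η * ε ^ (((p : ℝ) + 2 + max 1 (a * ((p : ℝ) - 1))) / ((p : ℝ) + 1))) ∧
          -- Case 2
          (ARpSoS.lamMin f (x k) < 0 →
            f (x k) - f (x k + s k) > η * κ₃ ^ 2 / (2 * (Λ 2 + 1)) * ε ^ 2) ∧
          -- Case 3
          (ε < ‖gradient f (x (k + 1))‖ →
            0 ≤ ARpSoS.lamMin f (x k) → ARpSoS.lamMin f (x k) ≤ ε ^ a →
            f (x k) - f (x k + s k) > η * κ₄ ^ 2 / 2 * ε ^ (2 - a)) := by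
  have hN := ARpSoS.four_le_regOrder hp
  set M := ((p - 1).factorial : ℝ) * L with hM
  have hMpos : 0 < M := by positivity
  -- Absolute values are taken because the signs of the `Λ j` are not prescribed; the summand `1`
  -- ensures `δ ≤ K`.
  set K := 1 + ∑ j ∈ Finset.Icc 1 p, |Λ j| with hKdef
  have hK1 : 1 ≤ K := by
    have : 0 ≤ ∑ j ∈ Finset.Icc 1 p, |Λ j| := Finset.sum_nonneg fun _ _ => abs_nonneg _
    linarith
  set K₂ := 1 + ∑ j ∈ Finset.Ico 3 (p + 1), (n : ℝ) ^ j * ((n : ℝ) ^ 2 * (p : ℝ) ^ 2 * |Λ j|)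
    with hK₂def
  have hK₂1 : 1 ≤ K₂ := by
    have : 0 ≤ ∑ j ∈ Finset.Ico 3 (p + 1), (n : ℝ) ^ j * ((n : ℝ) ^ 2 * (p : ℝ) ^ 2 * |Λ j|) :=
      Finset.sum_nonneg fun _ _ => by positivity
    linarith
  set Q := M * ARpSoS.regOrder p / (1 - η) with hQ
  have hQ0 : 0 ≤ Q := by
    have : 0 < 1 - η := by linarith
    positivity
  set S := σmin + K₂ ^ (2 * (p / 2)) + γ₁ * (Q * (2 * K + 1 + Q)) with hS
  have hSpos : 0 < S := by positivity
  set c₁ := min 1 (3 * S)⁻¹ / (3 * ARpSoS.regOrder p) with hc₁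
  set c₂ := (min (min 1 (3 * M)⁻¹) (32 * K)⁻¹) ^ 2 / 8 with hc₂
  set c₃ := 1 / (4 * (2 * K + 1 + S)) with hc₃
  have hc₁0 : 0 < c₁ := by positivity
  have hc₂0 : 0 < c₂ := by positivity
  have hc₃0 : 0 < c₃ := by positivity
  set c := min c₁ c₂ with hc
  have hc0 : 0 < c := lt_min hc₁0 hc₂0
  set c₄ := min c (1 / 18) with hc₄
  have hc₄0 : 0 < c₄ := by positivity
  -- The last two constants enter the claim squared; capping them at `1` makes their squares at most
  -- `c₃` and `c₄`.
  refine ⟨c, c, min 1 c₃, min 1 c₄, hc0, hc0, by positivity, by positivity, ?_⟩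
  intro f hf ε a γ₂ hε hε1 ha ha1 _ hγ₂ x s σr σbar σ hrun hΛ k hk hsucc
  have hδ : 0 < ε ^ a := by positivity
  have hδ1 : ε ^ a ≤ 1 := Real.rpow_le_one hε.le hε1.le ha
  have hK : ∀ k, ARpSoS.Performed f ε x k →
      ∑ j ∈ Finset.Icc 1 p, ‖iteratedFDeriv ℝ j f (x k)‖ ≤ K := fun k hk => by
    have : ∑ j ∈ Finset.Icc 1 p, ‖iteratedFDeriv ℝ j f (x k)‖ ≤ ∑ j ∈ Finset.Icc 1 p, |Λ j| :=
      Finset.sum_le_sum fun j hj => (hΛ k hk j hj).trans (le_abs_self _)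
    linarith
  have hK₂ : ∀ k, ARpSoS.Performed f ε x k → ∑ j ∈ Finset.Ico 3 (p + 1),
      (n : ℝ) ^ j * ((n : ℝ) ^ 2 * (p : ℝ) ^ 2 * ‖iteratedFDeriv ℝ j f (x k)‖) ≤ K₂ :=
    fun k hk => by
      have : ∑ j ∈ Finset.Ico 3 (p + 1),
          (n : ℝ) ^ j * ((n : ℝ) ^ 2 * (p : ℝ) ^ 2 * ‖iteratedFDeriv ℝ j f (x k)‖) ≤
          ∑ j ∈ Finset.Ico 3 (p + 1), (n : ℝ) ^ j * ((n : ℝ) ^ 2 * (p : ℝ) ^ 2 * |Λ j|) :=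
        Finset.sum_le_sum fun j hj => by
          have hj' := Finset.mem_Ico.1 hj
          have := (hΛ k hk j (Finset.mem_Icc.2 ⟨by omega, by omega⟩)).trans (le_abs_self _)
          gcongr
      linarith
  obtain ⟨hσlow, hσup⟩ := hrun.sigma_bounds hp hf hL hσmin hη1 hγ₁ hγ₂ hε hε1 ha
    (zero_le_one.trans hK1) hK₂1 hQ hK hK₂ k hk
  have hσ0 : 0 ≤ σ k := hσmin.le.trans hσlow
  have hstep := hrun.step k hk
  set D := f (x k) - ARpSoS.taylorModel f p (x k) (s k) with hD
  have hdec : η * D < f (x k) - f (x k + s k) :=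
    hsucc.lt_sub hη (ARpSoS.sub_taylorModel_nonneg hδ.le hσ0 hstep)
  have hreg := ARpSoS.regularization_le_sub_taylorModel hδ.le hstep
  have hconv : ARpSoS.IsSOSConvex (ARpSoS.sosModel f p (ε ^ a) (σ k) (x k)) := by
    refine (hrun.sos_program k hk).1.sosModel_mono ?_
    rw [hrun.σ_eq k hk]
    exact le_max_left _ _
  have hcvx := ARpSoS.convex_decrease (by omega) hf.contDiff hδ hσ0 hstep hconv (hK k hk)
    (hδ1.trans hK1)
  have hnext : ε < ‖gradient f (x (k + 1))‖ → ε < M * ‖s k‖ ^ p +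
      ARpSoS.perturbation (ε ^ a) (ARpSoS.lamMin f (x k)) * ‖s k‖ +
      σ k * ‖s k‖ ^ (ARpSoS.regOrder p - 1) := fun h => by
    rw [(hrun.success k hk hsucc).1, ARpSoS.norm_gradient] at h
    exact h.trans_le (hf.norm_fderiv_add_le (by omega) hL.le hδ.le hσ0 hstep)
  have hregular : ε / 3 ≤ σ k * ‖s k‖ ^ (ARpSoS.regOrder p - 1) ∨ ε / 3 ≤ M * ‖s k‖ ^ p →
      c * ε ^ ARpSoS.decreaseExponent p a ≤ D := by
    have hpow : 0 ≤ ε ^ ARpSoS.decreaseExponent p a := by positivity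
    rintro (h | h)
    · exact (mul_le_mul_of_nonneg_right (min_le_left _ _) hpow).trans
        (ARpSoS.decrease_of_le_reg hp hSpos hε (norm_nonneg _) hσup h hreg)
    · exact (mul_le_mul_of_nonneg_right (min_le_right _ _) hpow).trans
        (ARpSoS.decrease_of_le_taylor hp ha ha1 hMpos (zero_lt_one.trans_le hK1) hε hε1
          (norm_nonneg _) h hcvx)
  have hcase1 : ε < ‖gradient f (x (k + 1))‖ →
      ARpSoS.perturbation (ε ^ a) (ARpSoS.lamMin f (x k)) = 0 →
      c * ε ^ ARpSoS.decreaseExponent p a ≤ D := fun h h0 => by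
    have h1 := hnext h
    rw [h0, zero_mul, add_zero] at h1
    refine hregular ?_
    -- The perturbation is absent, so two terms below `ε / 3` cannot add up to `ε`.
    by_contra! hcon
    linarith [hcon.1, hcon.2]
  have hcase1' : ε < ‖gradient f (x (k + 1))‖ → ε ^ a ≤ ARpSoS.lamMin f (x k) →
      c * η * ε ^ ARpSoS.decreaseExponent p a < f (x k) - f (x k + s k) := fun h hl => by
    have h1 := hcase1 h (if_pos hl)
    calc c * η * ε ^ ARpSoS.decreaseExponent p a
        = η * (c * ε ^ ARpSoS.decreaseExponent p a) := by ring
      _ ≤ η * D := by gcongr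
      _ < _ := hdec
  refine ⟨fun h hodd hl => ?_, fun h heven hl => ?_, fun _ => ?_, fun h hl0 hl => ?_⟩
  · have h1 := hcase1' h hl
    rw [ARpSoS.decreaseExponent, ARpSoS.regOrder_of_odd hodd, ARpSoS.sigmaExponent_of_odd hodd,
      Nat.cast_add, Nat.cast_one, add_sub_cancel_right] at h1
    exact h1
  · have h1 := hcase1' h hl
    rw [ARpSoS.decreaseExponent, ARpSoS.regOrder_of_even heven,
      ARpSoS.sigmaExponent_of_even heven, Nat.cast_add, Nat.cast_two,
      show (p : ℝ) + 2 - 1 = p + 1 by ring] at h1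
    exact h1
  -- The Cauchy bound holds whatever the sign of the smallest eigenvalue. The factor `1 / (2 (Λ 2 +
  -- 1))` of the claim is at most `1` and is simply discarded.
  · have hg : ε < ‖gradient f (x k)‖ := hk k le_rfl
    have hg0 : gradient f (x k) ≠ 0 := norm_pos_iff.1 (hε.trans hg)
    have h1 : c₃ * ε ^ 2 ≤ D := ARpSoS.decrease_of_cauchy hp ha ha1 hK1 hSpos hε hε1 hg.le
      (ARpSoS.perturbation_lamMin_le (by omega) hf.contDiff hδ1 (hK k hk)) hσup
      (fun r hr hr1 => ARpSoS.cauchy_decrease (by omega) hδ.le hσ0 hstep (hK k hk) hr hr1 hg0)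
    have hΛ2 : 0 ≤ Λ 2 :=
      (norm_nonneg _).trans (hΛ k hk 2 (Finset.mem_Icc.2 ⟨by norm_num, by omega⟩))
    have h2 : min 1 c₃ ^ 2 ≤ c₃ := by
      calc min 1 c₃ ^ 2 = min 1 c₃ * min 1 c₃ := sq _
        _ ≤ 1 * c₃ := mul_le_mul (min_le_left _ _) (min_le_right _ _) (by positivity) zero_le_one
        _ = c₃ := one_mul _
    calc η * min 1 c₃ ^ 2 / (2 * (Λ 2 + 1)) * ε ^ 2
        ≤ η * c₃ / 1 * ε ^ 2 := by
          gcongr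
          linarith
      _ = η * (c₃ * ε ^ 2) := by ring
      _ ≤ η * D := by gcongr
      _ < _ := hdec
  · have hpow : 0 ≤ ε ^ (2 - a) := by positivity
    have hE : ε ^ (2 - a) ≤ ε ^ ARpSoS.decreaseExponent p a :=
      Real.rpow_le_rpow_of_exponent_ge hε hε1.le (ARpSoS.decreaseExponent_le hp ha1)
    have hc₄D : c₄ * ε ^ (2 - a) ≤ D := by
      -- The range of Case 3 is closed. At the endpoint `ε ^ a` the perturbation is `0`, as in Case
      -- 1; at the endpoint `0` the nonconvex formula gives `ε ^ a`.
      have hpert : ARpSoS.perturbation (ε ^ a) (ARpSoS.lamMin f (x k)) = 0 ∨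
          ARpSoS.perturbation (ε ^ a) (ARpSoS.lamMin f (x k)) = ε ^ a := by
        unfold ARpSoS.perturbation
        split_ifs with h1 h2
        · exact Or.inl rfl
        · exact Or.inr rfl
        · right
          linarith
      have hreg' : c * ε ^ ARpSoS.decreaseExponent p a ≤ D → c₄ * ε ^ (2 - a) ≤ D := fun h1 =>
        (mul_le_mul (min_le_left _ _) hE hpow hc0.le).trans h1
      rcases hpert with h0 | h0
      · exact hreg' (hcase1 h h0)
      · have h1 := hnext h
        have h2 := ARpSoS.le_sub_taylorModel hstep
        rw [h0] at h1 h2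
        by_cases h3 : ε / 3 ≤ ε ^ a * ‖s k‖
        · have h4 : 0 ≤ σ k / (ARpSoS.regOrder p : ℝ) * ‖s k‖ ^ ARpSoS.regOrder p := by positivity
          exact (mul_le_mul_of_nonneg_right (min_le_right _ _) hpow).trans
            (ARpSoS.decrease_of_le_perturbation hε h3 (by linarith))
        · refine hreg' (hregular ?_)
          by_contra! hcon
          linarith [hcon.1, hcon.2]
    have h2 : min 1 c₄ ^ 2 ≤ c₄ := by
      calc min 1 c₄ ^ 2 = min 1 c₄ * min 1 c₄ := sq _
        _ ≤ 1 * c₄ := mul_le_mul (min_le_left _ _) (min_le_right _ _) (by positivity) zero_le_one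
        _ = c₄ := one_mul _
    calc η * min 1 c₄ ^ 2 / 2 * ε ^ (2 - a)
        ≤ η * c₄ / 1 * ε ^ (2 - a) := by
          gcongr
          norm_num
      _ = η * (c₄ * ε ^ (2 - a)) := by ring
      _ ≤ η * D := by gcongr
      _ < _ := hdec
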